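/- Let $n\ge 0$, let $U\subseteq\mathbb{R}^n$ be open, and let $F_1:U\to\mathbb{R}^n$, $G_1:U\to\mathbb{R}$, $F_2:U\times\mathbb{R}\to\mathbb{R}^n$, $G_2:U\times\mathbb{R}\to\mathbb{R}$ be of class $C^2$, with $F_2,G_2$ $2\pi$-periodic in their last argument. For $\epsilon>0$ consider, on $U\times(\mathbb{R}/2\pi\mathbb{Z})$, the system $$\chi'=\epsilon F_1(\chi)+\epsilon^2F_2(\chi,\theta_1),\qquad \theta_1'=1+\epsilon G_1(\chi)+\epsilon^2G_2(\chi,\theta_1),$$ and the truncated system obtained by setting $F_2=G_2=0$. Let $\chi_0\in U$ satisfy $F_1(\chi_0)=0$, and suppose that every (complex) eigenvalue of $DF_1(\chi_0)$ has nonzero real part. Let $\lambda_1,\dots,\lambda_n\in\mathbb{C}$ be these eigenvalues, listed with algebraic multiplicity. A closed orbit is a nonconstant periodic orbit; a limit cycle is a closed orbit that has a neighbourhood containing no other closed orbit. The numbers $\mu_0,\dots,\mu_n\in\mathbb{C}$ are Floquet exponents of a closed orbit of least period $T$ if $e^{T\mu_0},\dots,e^{T\mu_n}$ are the eigenvalues,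 with algebraic multiplicity, of the monodromy matrix of the variational equation along the orbit. Then there are $\epsilon_0>0$ and $C$ such that for all $0<\epsilon<\epsilon_0$: 1. $\{\chi_0\}\times(\mathbb{R}/2\pi\mathbb{Z})$ is a limit cycle of the truncated system; 2. the full system has a limit cycle $\Gamma_\epsilon$ whose Hausdorff distance from $\{\chi_0\}\times(\mathbb{R}/2\pi\mathbb{Z})$ is at most $C\epsilon$; 3. $\Gamma_\epsilon$ has Floquet exponents $0,\mu_1(\epsilon),\dots,\mu_n(\epsilon)$ which agree with $0,\epsilon\lambda_1,\dots,\epsilon\lambda_n$ to order $\epsilon$: for every $i$, $\mu_i(\epsilon)-\epsilon\lambda_i=o(\epsilon)$ as $\epsilon\to0^+$ (in particular it is $O(\epsilon)$), and if $DF_1(\chi_0)$ is diagonalizable over $\mathbb{C}$, then $\mu_i(\epsilon)-\epsilon\lambda_i=O(\epsilon^2)$ for every $i$. -/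

import Mathlib

open Filter Topology Asymptotics

namespace SlowFast

/-- The slow variables `χ ∈ ℝⁿ`. -/
abbrev Slow (n : ℕ) : Type := EuclideanSpace ℝ (Fin n)

/-- Lifted phase space: the angle `θ` is represented by a real number. -/
abbrev Lifted (n : ℕ) : Type := Slow n × ℝ

/-- The phase space `ℝⁿ × ℝ/2πℤ`. -/
abbrev Cylinder (n : ℕ) : Type := Slow n × AddCircle (2 * Real.pi)

/-- The covering map from the lifted phase space to the phase space. -/
noncomputable def proj {n : ℕ} (p : Lifted n) : Cylinder n := (p.1, (p.2 : AddCircle (2 * Real.pi)))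

/-- The orbit of a (lifted) curve, as a subset of the phase space. -/
noncomputable def orbit {n : ℕ} (γ : ℝ → Lifted n) : Set (Cylinder n) := Set.range fun t => proj (γ t)

/-- The right-hand side of `χ' = ε F₁(χ) + ε² F₂(χ, θ)`, `θ' = 1 + ε G₁(χ) + ε² G₂(χ, θ)`. -/
noncomputable def fullField {n : ℕ} (F₁ : Slow n → Slow n) (G₁ : Slow n → ℝ)
    (F₂ : Slow n → ℝ → Slow n) (G₂ : Slow n → ℝ → ℝ) (ε : ℝ) (p : Lifted n) : Lifted n :=
  (ε • F₁ p.1 + ε ^ 2 • F₂ p.1 p.2, 1 + ε * G₁ p.1 + ε ^ 2 * G₂ p.1 p.2)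

/-- The right-hand side of the truncated system (`F₂ = 0`, `G₂ = 0`). -/
noncomputable def truncatedField {n : ℕ} (F₁ : Slow n → Slow n) (G₁ : Slow n → ℝ) (ε : ℝ) :
    Lifted n → Lifted n :=
  fullField F₁ G₁ (fun _ _ => 0) (fun _ _ => 0) ε

/-- `γ` is a solution of `p' = X p`, defined for all times and with values in `D`, that projects
to a nonconstant closed orbit of least period `T` in the phase space. -/
structure IsClosedOrbit {n : ℕ} (X : Lifted n → Lifted n) (D : Set (Lifted n))
    (γ : ℝ → Lifted n) (T : ℝ) : Prop where
  mem : ∀ t, γ t ∈ D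
  hasDerivAt : ∀ t, HasDerivAt γ (X (γ t)) t
  period_pos : 0 < T
  periodic : ∀ t, proj (γ (t + T)) = proj (γ t)
  least : ∀ s, 0 < s → s < T → ∃ t, proj (γ (t + s)) ≠ proj (γ t)

/-- A limit cycle is an isolated closed orbit: some neighbourhood of it contains no other
closed orbit. -/
def IsLimitCycle {n : ℕ} (X : Lifted n → Lifted n) (D : Set (Lifted n))
    (γ : ℝ → Lifted n) (T : ℝ) : Prop :=
  IsClosedOrbit X D γ T ∧
    ∃ V : Set (Cylinder n), IsOpen V ∧ orbit γ ⊆ V ∧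
      ∀ (γ' : ℝ → Lifted n) (T' : ℝ), IsClosedOrbit X D γ' T' → orbit γ' ⊆ V →
        orbit γ' = orbit γ

/-- `M` is the monodromy map of the variational equation `Φ' = DX(γ(t)) Φ` over `[0, T]`. -/
def IsMonodromy {n : ℕ} (X : Lifted n → Lifted n) (γ : ℝ → Lifted n) (T : ℝ)
    (M : Lifted n →L[ℝ] Lifted n) : Prop :=
  ∃ Φ : ℝ → (Lifted n →L[ℝ] Lifted n),
    Φ 0 = ContinuousLinearMap.id ℝ (Lifted n) ∧
    (∀ t, HasDerivAt Φ ((fderiv ℝ X (γ t)).comp (Φ t)) t) ∧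
    M = Φ T

/-- The complex eigenvalues of a real endomorphism, with algebraic multiplicity. -/
noncomputable def complexEigenvalues {V : Type*} [AddCommGroup V] [Module ℝ V]
    [Module.Finite ℝ V] [Module.Free ℝ V] (A : V →ₗ[ℝ] V) : Multiset ℂ :=
  (A.charpoly.map (algebraMap ℝ ℂ)).roots

/-- `s` is a complete list of Floquet exponents, with multiplicity, of the closed orbit `γ` of
period `T`: the numbers `exp (T μ)`, `μ ∈ s`, are the eigenvalues of the monodromy map. -/
def IsFloquetExponents {n : ℕ} (X : Lifted n → Lifted n) (γ : ℝ → Lifted n) (T : ℝ)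
    (s : Multiset ℂ) : Prop :=
  ∃ M : Lifted n →L[ℝ] Lifted n, IsMonodromy X γ T M ∧
    complexEigenvalues (M : Lifted n →ₗ[ℝ] Lifted n) = s.map fun μ => Complex.exp (T * μ)

end SlowFast

/-! Write A = DF₁(χ₀). For small ε the fast speed is at least 1/2, so the phase can replace time,
and orbits near χ₀ are governed by a 2π-periodic equation dχ/dθ = εF₁(χ) + O(ε²). Its linear part εA
degenerates with ε, but A is invertible because 0 is not on the imaginary-axis-free spectrum.
Splitting the equation into its mean, inverted by A⁻¹, and its oscillation, which gains a factor ε,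
yields a contraction (`exists_periodic_solution`). The residual at χ₀ is O(ε) after division by ε,
so the periodic solution y lies within O(ε) of χ₀. Integrating the scalar phase equation along the
graph of y (`exists_phase`) turns it into a closed orbit whose period is 2π + O(ε).

Isolation uses no Poincaré map. If another closed orbit (χ, θ) stays near χ₀, then w = χ - y(θ) is
periodic in time and w' = εAw up to an error ε·δ‖w‖ with δ small. A hyperbolic linear system bounds
its periodic solutions by the forcing, with a constant that does not depend on the period
(`exists_bound_of_periodic`); hence w = 0, however often the other orbit winds round the circle. The
truncated system is the case W = 0, y = χ₀.

For the exponents, the monodromy is M = 1 + TεD, where D differs by O(ε) from the derivative of the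
slow part of the field. The velocity v of the orbit is fixed by M, so Dv = 0, and dividing out v
leaves a map B = A + O(ε) of the slow space (`charpoly_eq_of_eigenvector`,
`IsControlled.exists_monodromy`). The multipliers are 1 and 1 + Tεb with b running over the
eigenvalues of B, and log(1 + Tεb)/T = εb + O(ε²). Continuity of polynomial roots gives b - λ =
o(1). When A is semisimple its minimal polynomial has simple roots, which improves this to O(ε)
(`eigenvalue_isBigO_of_isSemisimple`). -/

/-! ### Continuity of polynomial roots -/

open Polynomial in
/-- Roots of monic polynomials depend continuously on the coefficients: they can be labelled so
that each of them converges. -/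
theorem exists_tendsto_roots {α : Type*} {l : Filter α} (n : ℕ) (lam : Fin n → ℂ)
    (p : α → ℂ[X]) (hm : ∀ a, (p a).Monic) (hd : ∀ a, (p a).natDegree = n)
    (hc : ∀ k, Tendsto (fun a => (p a).coeff k) l (𝓝 ((∏ i, (X - C (lam i))).coeff k))) :
    ∃ μ : α → Fin n → ℂ, (∀ a, p a = ∏ i, (X - C (μ a i))) ∧
      ∀ i, Tendsto (fun a => μ a i) l (𝓝 (lam i)) := by
  induction n generalizing p with
  | zero =>
    refine ⟨fun _ => lam, fun a => ?_, fun i => i.elim0⟩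
    simpa using (hm a).natDegree_eq_zero.mp (hd a)
  | succ n ih =>
    -- Take the root nearest to `lam 0`: |p(`lam 0`)| is the product of the distances to all n + 1
    -- roots, so it dominates the smallest distance to the power n + 1.
    have hroot : ∀ a, ∃ r, (p a).IsRoot r ∧ ‖lam 0 - r‖ ^ (n + 1) ≤ ‖(p a).eval (lam 0)‖ := by
      intro a
      have hs : (p a).Splits := IsAlgClosed.splits _
      have hcard : Multiset.card (p a).roots = n + 1 := by
        rw [← hs.natDegree_eq_card_roots, hd a]
      have hne : (p a).roots.toFinset.Nonempty := by
        rw [Multiset.toFinset_nonempty, ← Multiset.card_pos]; omega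
      obtain ⟨r, hr, hmin⟩ := (p a).roots.toFinset.exists_min_image (fun r => ‖lam 0 - r‖) hne
      refine ⟨r, isRoot_of_mem_roots (Multiset.mem_toFinset.mp hr), ?_⟩
      rw [hs.eval_eq_prod_roots_of_monic (hm a)]
      have h1 := Multiset.prod_map_le_prod_map₀ (s := (p a).roots) (fun _ => ‖lam 0 - r‖)
        (fun x => ‖lam 0 - x‖) (fun _ _ => norm_nonneg _)
        (fun x hx => hmin x (Multiset.mem_toFinset.mpr hx))
      rw [Multiset.map_const', Multiset.prod_replicate, hcard] at h1
      refine h1.trans (le_of_eq ?_)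
      have := Multiset.prod_hom ((p a).roots.map fun x => lam 0 - x) (normHom (α := ℂ))
      simpa [Multiset.map_map] using this
    choose r hr hrle using hroot
    have heval : Tendsto (fun a => (p a).eval (lam 0)) l (𝓝 0) := by
      have h0 : (∏ i, (X - C (lam i))).eval (lam 0) = 0 := by
        rw [eval_prod]; exact Finset.prod_eq_zero (Finset.mem_univ 0) (by simp)
      have hdeg : (∏ i, (X - C (lam i))).natDegree = n + 1 := by
        simp
      rw [← h0, eval_eq_sum_range, hdeg]
      simp_rw [eval_eq_sum_range, hd]
      exact tendsto_finsetSum _ fun k _ => (hc k).mul_const _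
    have hrlim : Tendsto r l (𝓝 (lam 0)) := by
      rw [Metric.tendsto_nhds]
      intro e he
      have := (Metric.tendsto_nhds.mp heval) (e ^ (n + 1)) (by positivity)
      filter_upwards [this] with a ha
      rw [dist_zero_right] at ha
      rw [dist_eq_norm, norm_sub_rev]
      exact lt_of_pow_lt_pow_left₀ _ he.le ((hrle a).trans_lt ha)
    choose q hq using fun a => dvd_iff_isRoot.mpr (hr a)
    have hqm : ∀ a, (q a).Monic := fun a => by
      have := hm a
      rw [hq a] at this
      exact (monic_X_sub_C _).of_mul_monic_left this
    have hqd : ∀ a, (q a).natDegree = n := fun a => by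
      have := hd a
      rw [hq a, (monic_X_sub_C _).natDegree_mul (hqm a), natDegree_X_sub_C] at this
      omega
    -- Synthetic division: the coefficients of the quotient are recovered from the top degree
    -- downwards, so their convergence follows by descending induction on the degree.
    have hcoef : ∀ (s : ℂ) (u : ℂ[X]) (k : ℕ),
        u.coeff k = ((X - C s) * u).coeff (k + 1) + s * u.coeff (k + 1) := by
      intro s u k
      rw [sub_mul, coeff_sub, coeff_X_mul, coeff_C_mul]; ring
    have hqc : ∀ k, Tendsto (fun a => (q a).coeff k) l
        (𝓝 ((∏ i : Fin n, (X - C (lam i.succ))).coeff k)) := by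
      have hbig : ∀ k, n < k → Tendsto (fun a => (q a).coeff k) l
          (𝓝 ((∏ i : Fin n, (X - C (lam i.succ))).coeff k)) := by
        intro k hk
        rw [coeff_eq_zero_of_natDegree_lt (by simpa using hk)]
        refine tendsto_const_nhds.congr fun a => ?_
        rw [coeff_eq_zero_of_natDegree_lt (by simpa [hqd] using hk)]
      have hdesc : ∀ j k, n < k + j → Tendsto (fun a => (q a).coeff k) l
          (𝓝 ((∏ i : Fin n, (X - C (lam i.succ))).coeff k)) := by
        intro j
        induction j with
        | zero => exact fun k hk => hbig k hk
        | succ j ihj =>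
          intro k hk
          rw [hcoef (lam 0)]
          have h1 := hc (k + 1)
          rw [Fin.prod_univ_succ] at h1
          refine (h1.add (hrlim.mul (ihj (k + 1) (by omega)))).congr fun a => ?_
          rw [hcoef (r a) (q a) k, ← hq a]
      exact fun k => hdesc (n + 1) k (by omega)
    obtain ⟨μ, hμ, hμl⟩ := ih (fun i => lam i.succ) q hqm hqd hqc
    refine ⟨fun a => Fin.cons (r a) (μ a), fun a => ?_, fun i => ?_⟩
    · rw [Fin.prod_univ_succ, hq a, hμ a]
      simp
    · refine Fin.cases ?_ (fun j => ?_) i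
      · simpa using hrlim
      · simpa using hμl j

/-! ### Perturbation of eigenvalues -/

section Eigenvalues

variable {V : Type*} [NormedAddCommGroup V] [NormedSpace ℝ V] [FiniteDimensional ℝ V]

/-- The complexified matrix of an endomorphism, as an algebra homomorphism. -/
noncomputable def complexMatrix (V : Type*) [AddCommGroup V] [Module ℝ V]
    [FiniteDimensional ℝ V] : Module.End ℝ V →ₐ[ℝ]
      Matrix (Fin (Module.finrank ℝ V)) (Fin (Module.finrank ℝ V)) ℂ :=
  (Algebra.ofId ℝ ℂ).mapMatrix.comp
    (LinearMap.toMatrixAlgEquiv (Module.finBasis ℝ V) : Module.End ℝ V →ₐ[ℝ] _)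

theorem charpoly_complexMatrix {V : Type*} [AddCommGroup V] [Module ℝ V]
    [FiniteDimensional ℝ V] (A : Module.End ℝ V) :
    (complexMatrix V A).charpoly = A.charpoly.map (algebraMap ℝ ℂ) := by
  rw [← LinearMap.charpoly_toMatrix A (Module.finBasis ℝ V), ← Matrix.charpoly_map]
  rfl

attribute [local instance] Matrix.linftyOpNormedRing Matrix.linftyOpNormedAlgebra

/-- The complexified matrix of a continuous endomorphism, as a continuous linear map. -/
noncomputable def complexMatrixL (V : Type*) [NormedAddCommGroup V] [NormedSpace ℝ V]
    [FiniteDimensional ℝ V] : (V →L[ℝ] V) →L[ℝ]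
      Matrix (Fin (Module.finrank ℝ V)) (Fin (Module.finrank ℝ V)) ℂ :=
  LinearMap.toContinuousLinearMap
    ((complexMatrix V).toLinearMap ∘ₗ ContinuousLinearMap.coeLM ℝ)

theorem complexMatrixL_apply (A : V →L[ℝ] V) :
    complexMatrixL V A = complexMatrix V (A : V →ₗ[ℝ] V) := rfl

theorem continuous_charpoly_coeff {m : Type*} [Fintype m] [DecidableEq m] (k : ℕ) :
    Continuous fun M : Matrix m m ℂ => M.charpoly.coeff k := by
  have : (fun M : Matrix m m ℂ => M.charpoly.coeff k) = fun M =>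
      MvPolynomial.eval (fun ij : m × m => M ij.1 ij.2)
        ((Matrix.charpoly.univ ℂ m).coeff k) := by
    funext M
    have := Matrix.charpoly.univ_coeff_eval₂Hom m (RingHom.id ℂ) (fun ij : m × m => M ij.1 ij.2) k
    exact this.symm
  rw [this]
  refine (MvPolynomial.continuous_eval _).comp ?_
  fun_prop

/-- The coefficients of the characteristic polynomial are polynomials in the matrix entries, hence
continuous, and `exists_tendsto_roots` labels the roots. -/
theorem exists_tendsto_eigenvalues {α : Type*} {l : Filter α} {n : ℕ}
    (hn : Module.finrank ℝ V = n) {A : V →L[ℝ] V}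
    {B : α → V →L[ℝ] V} (hB : Tendsto B l (𝓝 A)) {lam : Fin n → ℂ}
    (hlam : Finset.univ.val.map lam = SlowFast.complexEigenvalues (A : V →ₗ[ℝ] V)) :
    ∃ b : α → Fin n → ℂ,
      (∀ a, (B a : V →ₗ[ℝ] V).charpoly.map (algebraMap ℝ ℂ) =
        ∏ i, (Polynomial.X - Polynomial.C (b a i))) ∧
      ∀ i, Tendsto (fun a => b a i) l (𝓝 (lam i)) := by
  refine exists_tendsto_roots n lam _ (fun a => (LinearMap.charpoly_monic _).map _)
    (fun a => ?_) (fun k => ?_)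
  · rw [(LinearMap.charpoly_monic _).natDegree_map, LinearMap.charpoly_natDegree, hn]
  · have h1 : ∏ i, (Polynomial.X - Polynomial.C (lam i)) =
        (A : V →ₗ[ℝ] V).charpoly.map (algebraMap ℝ ℂ) := by
      have := (IsAlgClosed.splits
        ((A : V →ₗ[ℝ] V).charpoly.map (algebraMap ℝ ℂ))).eq_prod_roots_of_monic
          ((LinearMap.charpoly_monic _).map _)
      rw [this, show (Polynomial.map (algebraMap ℝ ℂ) (A : V →ₗ[ℝ] V).charpoly).roots =
        Finset.univ.val.map lam from hlam.symm, Multiset.map_map]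
      rfl
    rw [h1]
    simp_rw [← charpoly_complexMatrix, ← complexMatrixL_apply]
    exact ((continuous_charpoly_coeff k).tendsto _).comp
      (((complexMatrixL V).continuous.tendsto _).comp hB)

open Polynomial in
-- By spectral mapping p(z) is a spectral value of p(B), and spectral values are bounded by the
-- norm. The factor ‖1‖ covers dimension zero, where the unit matrix has norm 0.
theorem norm_eval_le_of_isRoot_charpoly (B : V →L[ℝ] V) (p : ℝ[X]) {z : ℂ}
    (hz : ((B : V →ₗ[ℝ] V).charpoly.map (algebraMap ℝ ℂ)).IsRoot z) :
    ‖(p.map (algebraMap ℝ ℂ)).eval z‖ ≤ ‖aeval (complexMatrixL V B) p‖ *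
      ‖(1 : Matrix (Fin (Module.finrank ℝ V)) (Fin (Module.finrank ℝ V)) ℂ)‖ := by
  refine spectrum.norm_le_norm_mul_of_mem ?_
  have := spectrum.subset_polynomial_aeval (complexMatrixL V B) (p.map (algebraMap ℝ ℂ))
  rw [aeval_map_algebraMap] at this
  refine this ⟨z, ?_, rfl⟩
  rw [Matrix.mem_spectrum_iff_isRoot_charpoly, complexMatrixL_apply, charpoly_complexMatrix]
  exact hz

open Polynomial in
/-- Near a semisimple endomorphism the eigenvalues are Lipschitz. -/
theorem eigenvalue_isBigO_of_isSemisimple {α : Type*} {l : Filter α} {A : V →L[ℝ] V}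
    (hA : Module.End.IsSemisimple (A : V →ₗ[ℝ] V)) {B : α → V →L[ℝ] V}
    (hB : Tendsto B l (𝓝 A)) {e : α → ℝ} (hBe : (fun a => B a - A) =O[l] e)
    {z : ℂ} (hz : z ∈ SlowFast.complexEigenvalues (A : V →ₗ[ℝ] V)) {b : α → ℂ}
    (hb : ∀ a, ((B a : V →ₗ[ℝ] V).charpoly.map (algebraMap ℝ ℂ)).IsRoot (b a))
    (hbz : Tendsto b l (𝓝 z)) : (fun a => b a - z) =O[l] e := by
  -- Semisimplicity makes the minimal polynomial p separable, so z is a simple root, and |b - z| ≲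
  -- |p(b)| ≲ ‖p(B)‖ = ‖p(B) - p(A)‖ ≲ ‖B - A‖.
  set p := minpoly ℝ (A : V →ₗ[ℝ] V) with hp
  have hsep : p.Separable := PerfectField.separable_iff_squarefree.mpr hA.minpoly_squarefree
  have h0 : aeval (complexMatrixL V A) p = 0 := by
    rw [complexMatrixL_apply, aeval_algHom_apply, hp, minpoly.aeval, map_zero]
  have hzroot : (p.map (algebraMap ℝ ℂ)).eval z = 0 := by
    have h := norm_eval_le_of_isRoot_charpoly A p (isRoot_of_mem_roots hz)
    rw [h0, norm_zero, zero_mul] at h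
    exact norm_le_zero_iff.mp h
  have hderiv : (derivative (p.map (algebraMap ℝ ℂ))).eval z ≠ 0 :=
    (hsep.map (f := algebraMap ℝ ℂ)).eval₂_derivative_ne_zero (RingHom.id ℂ) hzroot
  have h1 : (fun a => b a - z) =O[l] fun a => (p.map (algebraMap ℝ ℂ)).eval (b a) := by
    have h := ((p.map (algebraMap ℝ ℂ)).hasDerivAt z).isTheta_sub hderiv
    have hbz' : Tendsto (fun a => (b a, z)) l (𝓝 z ×ˢ pure z) :=
      hbz.prodMk (tendsto_pure.mpr (Eventually.of_forall fun _ => rfl))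
    simpa only [hzroot, Function.comp_def, sub_zero] using h.isBigO_symm.comp_tendsto hbz'
  have h2 : (fun a => (p.map (algebraMap ℝ ℂ)).eval (b a)) =O[l]
      fun a => aeval (complexMatrixL V (B a)) p := by
    refine IsBigO.of_bound ‖(1 : Matrix (Fin (Module.finrank ℝ V)) (Fin (Module.finrank ℝ V)) ℂ)‖
      (Eventually.of_forall fun a => ?_)
    rw [mul_comm]
    exact norm_eval_le_of_isRoot_charpoly (B a) p (hb a)
  have h3 : (fun a => aeval (complexMatrixL V (B a)) p) =O[l] fun a => B a - A := by
    have hd : DifferentiableAt ℝ (fun M : V →L[ℝ] V => aeval (complexMatrixL V M) p) A := by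
      have : (fun M : V →L[ℝ] V => aeval (complexMatrixL V M) p) = fun M =>
          ∑ i ∈ Finset.range (p.natDegree + 1), p.coeff i • (complexMatrixL V M) ^ i := by
        funext M; rw [aeval_eq_sum_range]
      rw [this]
      refine DifferentiableAt.fun_sum fun i _ => ?_
      exact ((complexMatrixL V).differentiableAt.fun_pow i).fun_const_smul _
    have := hd.isBigO_sub.comp_tendsto hB
    simpa [h0, Function.comp_def] using this
  exact h1.trans (h2.trans (h3.trans hBe))

end Eigenvalues

/-! ### Periodic solutions of hyperbolic linear systems -/

theorem exists_forall_norm_le_of_periodic {E : Type*} [NormedAddCommGroup E] {w : ℝ → E} {P : ℝ}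
    (hP : 0 < P) (hper : Function.Periodic w P) (hw : Continuous w) :
    ∃ t₀, ∀ t, ‖w t‖ ≤ ‖w t₀‖ := by
  obtain ⟨t₀, -, h⟩ := isCompact_Icc.exists_isMaxOn (s := Set.Icc 0 P)
    ⟨0, Set.left_mem_Icc.mpr hP.le⟩ hw.norm.continuousOn
  refine ⟨t₀, fun t => ?_⟩
  obtain ⟨s, hs, hst⟩ := hper.exists_mem_Ico₀ hP t
  rw [hst]
  exact h (Set.Ico_subset_Icc_self hs)

/-- Where |u|² is maximal its derivative vanishes, so Re z·|u|² = -⟨u, h⟩ there. The period only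
ensures that the maximum is attained and does not enter the bound. -/
theorem norm_le_of_periodic_scalar {z : ℂ} (hz : z.re ≠ 0) {u h : ℝ → ℂ} {P G : ℝ} (hP : 0 < P)
    (hper : Function.Periodic u P) (hu : ∀ t, HasDerivAt u (z * u t + h t) t)
    (hG : ∀ t, ‖h t‖ ≤ G) (t : ℝ) : ‖u t‖ ≤ |z.re|⁻¹ * G := by
  have hcont : Continuous u := continuous_iff_continuousAt.mpr fun t => (hu t).continuousAt
  obtain ⟨t₀, ht₀⟩ := exists_forall_norm_le_of_periodic hP hper hcont
  refine (ht₀ t).trans ?_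
  have hmax : IsLocalMax (fun t => ‖u t‖ ^ 2) t₀ :=
    Eventually.of_forall fun s => pow_le_pow_left₀ (norm_nonneg _) (ht₀ s) 2
  have h0 := hmax.hasDerivAt_eq_zero (hu t₀).norm_sq
  have h1 : inner ℝ (u t₀) (z * u t₀ + h t₀) =
      z.re * ‖u t₀‖ ^ 2 + inner ℝ (u t₀) (h t₀) := by
    rw [inner_add_right, Complex.inner]
    congr 1
    rw [← Complex.normSq_eq_norm_sq, Complex.normSq_apply]
    simp
    ring
  have h2 := abs_real_inner_le_norm (u t₀) (h t₀)
  have h3 : |z.re| * ‖u t₀‖ ^ 2 ≤ ‖u t₀‖ * G := by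
    have : z.re * ‖u t₀‖ ^ 2 = -inner ℝ (u t₀) (h t₀) := by linarith
    rw [← abs_of_nonneg (sq_nonneg ‖u t₀‖), ← abs_mul, this, abs_neg]
    exact h2.trans (mul_le_mul_of_nonneg_left (hG t₀) (norm_nonneg _))
  have hz' : 0 < |z.re| := abs_pos.mpr hz
  rw [inv_mul_eq_div, le_div_iff₀ hz']
  rcases (norm_nonneg (u t₀)).eq_or_lt with h | h
  · rw [← h, zero_mul]; exact (norm_nonneg _).trans (hG 0)
  · nlinarith

/-- Periodic solutions of a hyperbolic linear system are controlled by the forcing term,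
uniformly in the period. -/
theorem exists_bound_of_periodic (n : ℕ) : ∀ (V : Type) [NormedAddCommGroup V] [NormedSpace ℂ V]
    [FiniteDimensional ℂ V], Module.finrank ℂ V ≤ n → ∀ A : V →L[ℂ] V,
    (∀ z, Module.End.HasEigenvalue (A : V →ₗ[ℂ] V) z → z.re ≠ 0) →
    ∃ K, ∀ (w g : ℝ → V) (P : ℝ), 0 < P → Function.Periodic w P →
      (∀ t, HasDerivAt w (A (w t) + g t) t) → ∀ G, (∀ t, ‖g t‖ ≤ G) → ∀ t, ‖w t‖ ≤ K * G := by
  induction n with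
  | zero =>
    intro V _ _ _ hV A _
    have : Subsingleton V := Module.finrank_zero_iff.mp (Nat.le_zero.mp hV)
    exact ⟨0, fun w g P _ _ _ G _ t => by simp [Subsingleton.elim (w t) 0]⟩
  | succ n ih =>
    intro V _ _ _ hV A hA
    rcases subsingleton_or_nontrivial V with hs | hnt
    · exact ⟨0, fun w g P _ _ _ G _ t => by simp [Subsingleton.elim (w t) 0]⟩
    -- Triangularisation: an eigenvector φ of the transpose gives a scalar equation for φ(w) and an
    -- A-invariant hyperplane ker φ, to which the induction hypothesis applies.
    obtain ⟨z, hz⟩ := Module.End.exists_eigenvalue (K := ℂ) (V := Module.Dual ℂ V)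
      (Module.Dual.transpose (R := ℂ) (A : V →ₗ[ℂ] V))
    obtain ⟨φ', hφ'⟩ := hz.exists_hasEigenvector
    have hφA' : ∀ x, φ' (A x) = z * φ' x := fun x => by
      exact LinearMap.congr_fun hφ'.apply_eq_smul x
    obtain ⟨x, hx⟩ : ∃ x, φ' x ≠ 0 := by
      by_contra! h
      exact hφ'.2 (LinearMap.ext h)
    -- z is also an eigenvalue of A: φ vanishes on the range of z - A but not at x, so z - A is not
    -- surjective.
    have hzA : z.re ≠ 0 := by
      refine hA z ?_
      rw [Module.End.hasEigenvalue_iff_mem_spectrum, spectrum.mem_iff, Module.End.isUnit_iff]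
      intro hbij
      obtain ⟨y, hy⟩ := hbij.2 x
      apply hx
      rw [← hy]
      simp [hφA', Module.algebraMap_end_apply]
    set φ : V →L[ℂ] ℂ := LinearMap.toContinuousLinearMap φ' with hφdef
    have hφA : ∀ x, φ (A x) = z * φ x := hφA'
    set e : V := (φ x)⁻¹ • x
    have he : φ e = 1 := by
      simp only [e, map_smul, smul_eq_mul]
      exact inv_mul_cancel₀ hx
    set W : Submodule ℂ V := LinearMap.ker (φ : V →ₗ[ℂ] ℂ) with hW
    have hmemW : ∀ y, y ∈ W ↔ φ y = 0 := fun y => by simp [hW]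
    have hfin : Module.finrank ℂ W ≤ n := by
      have : Module.finrank ℂ W < Module.finrank ℂ V := by
        apply Submodule.finrank_lt
        intro h
        have : x ∈ W := h ▸ Submodule.mem_top
        exact hx ((hmemW x).mp this)
      omega
    set B : W →L[ℂ] W := (A.comp W.subtypeL).codRestrict W (fun y => by
      rw [hmemW]
      simp [hφA, (hmemW y).mp y.2]) with hB
    obtain ⟨K, hK⟩ := ih W hfin B (fun s hs => by
      refine hA s ?_
      obtain ⟨v, hv⟩ := hs.exists_hasEigenvector
      refine Module.End.hasEigenvalue_of_hasEigenvector (x := (v : V)) ⟨?_, ?_⟩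
      · rw [Module.End.mem_eigenspace_iff]
        exact congrArg Subtype.val hv.apply_eq_smul
      · exact fun h => hv.2 (Subtype.ext h))
    set π : V →L[ℂ] W := (ContinuousLinearMap.id ℂ V - φ.smulRight e).codRestrict W (fun y => by
      rw [hmemW]
      simp [he]) with hπ
    have hπv : ∀ y, (π y : V) = y - φ y • e := fun y => rfl
    refine ⟨K * (|z.re|⁻¹ * ‖φ‖ * ‖π (A e)‖ + ‖π‖) + |z.re|⁻¹ * ‖φ‖ * ‖e‖, ?_⟩
    intro w g P hP hper hw G hG t
    have hG0 : 0 ≤ G := (norm_nonneg _).trans (hG 0)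
    have hu : ∀ t, ‖φ (w t)‖ ≤ |z.re|⁻¹ * (‖φ‖ * G) := by
      refine norm_le_of_periodic_scalar hzA (h := fun t => φ (g t)) hP
        (fun t => by simp only [hper t]) (fun t => ?_) (fun t => φ.le_opNorm_of_le (hG t))
      have := (φ.restrictScalars ℝ).hasFDerivAt.comp_hasDerivAt t (hw t)
      simpa [hφA, Function.comp_def] using this
    -- Projecting along e gives π(Ay) = B(πy) + φ(y)·π(Ae), so the component in ker φ solves the
    -- system of B with the already bounded φ(w) as extra forcing.
    have hz' : ∀ t, ‖π (w t)‖ ≤ K * (|z.re|⁻¹ * (‖φ‖ * G) * ‖π (A e)‖ + ‖π‖ * G) := by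
      refine hK (fun t => π (w t)) (fun t => φ (w t) • π (A e) + π (g t)) P hP
        (fun t => by simp only [hper t]) (fun t => ?_) _ (fun t => ?_)
      · have := (π.restrictScalars ℝ).hasFDerivAt.comp_hasDerivAt t (hw t)
        refine this.congr_deriv ?_
        apply Subtype.ext
        simp only [hπ, hB, ContinuousLinearMap.coe_restrictScalars', Submodule.coe_add,
          Submodule.coe_smul, ContinuousLinearMap.coe_codRestrict_apply, map_add]
        simp [hφA, he, smul_sub]
        module
      · refine (norm_add_le _ _).trans (add_le_add ?_ (π.le_opNorm_of_le (hG t)))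
        rw [norm_smul]
        exact mul_le_mul_of_nonneg_right (hu t) (norm_nonneg _)
    have hdec : w t = (π (w t) : V) + φ (w t) • e := by rw [hπv]; abel
    have h1 : ‖w t‖ ≤ ‖π (w t)‖ + ‖φ (w t)‖ * ‖e‖ := by
      conv_lhs => rw [hdec]
      exact (norm_add_le _ _).trans (by rw [norm_smul]; rfl)
    have h2 := mul_le_mul_of_nonneg_right (hu t) (norm_nonneg e)
    linarith [hz' t]

section Hyperbolic

variable {V : Type*} [NormedAddCommGroup V] [NormedSpace ℝ V] [FiniteDimensional ℝ V]

/-- Coordinates in a basis embed V into ℂᵈ and intertwine A with its complex matrix. The embedding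
is bounded below, so the complex bound pulls back. -/
theorem exists_bound_of_periodic_real {A : V →L[ℝ] V}
    (hA : ∀ z ∈ SlowFast.complexEigenvalues (A : V →ₗ[ℝ] V), z.re ≠ 0) :
    ∃ K, ∀ (w g : ℝ → V) (P : ℝ), 0 < P → Function.Periodic w P →
      (∀ t, HasDerivAt w (A (w t) + g t) t) → ∀ G, (∀ t, ‖g t‖ ≤ G) → ∀ t, ‖w t‖ ≤ K * G := by
  let d := Module.finrank ℝ V
  let bas := Module.finBasis ℝ V
  let N : Matrix (Fin d) (Fin d) ℂ := complexMatrix V (A : V →ₗ[ℝ] V)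
  obtain ⟨K, hK⟩ := exists_bound_of_periodic d (Fin d → ℂ) (by simp)
    (LinearMap.toContinuousLinearMap (Matrix.toLin' N)) (fun z hz => by
      refine hA z ?_
      rw [SlowFast.complexEigenvalues, Polynomial.mem_roots
        ((LinearMap.charpoly_monic _).map _).ne_zero, ← charpoly_complexMatrix,
        ← Matrix.charpoly_toLin', ← Module.End.hasEigenvalue_iff_isRoot_charpoly]
      rwa [LinearMap.coe_toContinuousLinearMap] at hz)
  set J' : V →ₗ[ℝ] (Fin d → ℂ) :=
    { toFun := fun x i => (bas.repr x i : ℂ)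
      map_add' := fun x y => by ext i; simp
      map_smul' := fun c x => by ext i; simp }
  have hinj : Function.Injective J' := by
    intro x y hxy
    apply bas.repr.injective
    ext i
    exact Complex.ofReal_injective (congrFun hxy i)
  set J : V →L[ℝ] (Fin d → ℂ) := LinearMap.toContinuousLinearMap J'
  have hJJ' : ∀ x, J x = J' x := fun x => by simp [J]
  have hJA : ∀ x, J (A x) = N.mulVec (J x) := by
    intro x
    ext i
    have h := congrFun (LinearMap.toMatrix_mulVec_repr bas bas (A : V →ₗ[ℝ] V) x) i
    have h' := congrArg (Complex.ofReal) h
    simp only [Matrix.mulVec, dotProduct, Complex.ofReal_sum, Complex.ofReal_mul] at h'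
    have hN : ∀ j, N i j = (LinearMap.toMatrix bas bas (A : V →ₗ[ℝ] V) i j : ℂ) := fun j => by
      rfl
    have hJ : ∀ x j, J' x j = (bas.repr x j : ℂ) := fun x j => by rfl
    rw [hJJ', hJJ', hJ, Matrix.mulVec, dotProduct]
    simp only [hN, hJ]
    exact h'.symm
  obtain ⟨c, -, hc⟩ := LinearMap.exists_antilipschitzWith J'
    (LinearMap.ker_eq_bot.mpr hinj)
  refine ⟨c * (K * ‖J‖), fun w g P hP hper hw G hG t => ?_⟩
  have h1 : ‖w t‖ ≤ c * ‖J (w t)‖ := by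
    have := hc.le_mul_dist (w t) 0
    simpa [hJJ'] using this
  have h2 := hK (fun t => J (w t)) (fun t => J (g t)) P hP (fun t => by simp only [hper t])
    (fun t => by
      have := J.hasFDerivAt.comp_hasDerivAt t (hw t)
      simpa [hJA, Function.comp_def] using this) (‖J‖ * G) (fun t => J.le_opNorm_of_le (hG t)) t
  calc ‖w t‖ ≤ c * ‖J (w t)‖ := h1
    _ ≤ c * (K * (‖J‖ * G)) := mul_le_mul_of_nonneg_left h2 c.2
    _ = _ := by ring

/-- A hyperbolic slow linear system with a small relative perturbation has no periodic solution
but zero. -/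
theorem exists_pos_eq_zero_of_periodic {A : V →L[ℝ] V}
    (hA : ∀ z ∈ SlowFast.complexEigenvalues (A : V →ₗ[ℝ] V), z.re ≠ 0) :
    ∃ δ > 0, ∀ (w w' : ℝ → V) (P ε : ℝ), 0 < P → 0 < ε → Function.Periodic w P →
      (∀ t, HasDerivAt w (w' t) t) → (∀ t, ‖w' t - ε • A (w t)‖ ≤ ε * (δ * ‖w t‖)) →
      ∀ t, w t = 0 := by
  obtain ⟨K, hK⟩ := exists_bound_of_periodic_real hA
  -- With this δ one has Kδ ≤ 1/2, so the maximum of ‖w‖ is at most half of itself.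
  refine ⟨(2 * (|K| + 1))⁻¹, by positivity, fun w w' P ε hP hε hper hw hle t => ?_⟩
  set δ := (2 * (|K| + 1))⁻¹
  obtain ⟨t₀, ht₀⟩ := exists_forall_norm_le_of_periodic hP hper
    (continuous_iff_continuousAt.mpr fun t => (hw t).continuousAt)
  have hδ : 0 < δ := by positivity
  -- In the slow time εt the linear part is A itself and the period is εP; K is the same for all
  -- these periods.
  have h := hK (fun t => w (ε⁻¹ * t)) (fun t => ε⁻¹ • (w' (ε⁻¹ * t) - ε • A (w (ε⁻¹ * t)))) (ε * P)
    (by positivity) (fun t => by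
      change w (ε⁻¹ * (t + ε * P)) = w (ε⁻¹ * t)
      rw [mul_add, inv_mul_cancel_left₀ hε.ne', hper])
    (fun t => by
      have := (hw (ε⁻¹ * t)).scomp t ((hasDerivAt_id t).const_mul ε⁻¹)
      refine this.congr_deriv ?_
      rw [smul_sub, smul_smul, inv_mul_cancel₀ hε.ne']
      simp) (δ * ‖w t₀‖) (fun t => by
      rw [norm_smul, norm_inv, Real.norm_of_nonneg hε.le, inv_mul_le_iff₀ hε]
      refine (hle _).trans ?_
      gcongr
      exact ht₀ _) (ε * t₀)
  rw [inv_mul_cancel_left₀ hε.ne'] at h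
  have hKδ : K * δ ≤ 1 / 2 := by
    simp only [δ]
    rw [mul_inv_le_iff₀ (by positivity)]
    linarith [le_abs_self K]
  have h0 : ‖w t₀‖ = 0 := by nlinarith [norm_nonneg (w t₀)]
  exact norm_le_zero_iff.mp ((ht₀ t).trans h0.le)

end Hyperbolic

/-! ### Periodic solutions of slowly varying periodic systems -/

section PeriodicSolution

variable {E : Type*} [NormedAddCommGroup E] [NormedSpace ℝ E]

/-- The mean of a `2π`-periodic function. -/
noncomputable def circleMean (h : ℝ → E) : E :=
  (2 * Real.pi)⁻¹ • ∫ s in (0 : ℝ)..(2 * Real.pi), h s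

/-- The primitive of `h - circleMean h` that vanishes at the origin. -/
noncomputable def oscillationPrimitive (h : ℝ → E) (x : ℝ) : E :=
  ∫ s in (0 : ℝ)..x, (h s - circleMean h)

theorem norm_circleMean_le {h : ℝ → E} {G : ℝ} (hG : ∀ s, ‖h s‖ ≤ G) : ‖circleMean h‖ ≤ G := by
  have h1 := intervalIntegral.norm_integral_le_of_norm_le_const (a := 0) (b := 2 * Real.pi)
    (fun s _ => hG s)
  rw [circleMean, norm_smul, norm_inv, Real.norm_of_nonneg Real.two_pi_pos.le,
    inv_mul_le_iff₀ Real.two_pi_pos, mul_comm _ G]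
  rwa [sub_zero, abs_of_pos Real.two_pi_pos] at h1

theorem circleMean_sub {h k : ℝ → E} (hh : Continuous h) (hk : Continuous k) :
    circleMean (fun s => h s - k s) = circleMean h - circleMean k := by
  rw [circleMean, intervalIntegral.integral_sub (hh.intervalIntegrable _ _)
    (hk.intervalIntegrable _ _), smul_sub]
  rfl

theorem circleMean_add {h k : ℝ → E} (hh : Continuous h) (hk : Continuous k) :
    circleMean (fun s => h s + k s) = circleMean h + circleMean k := by
  rw [circleMean, intervalIntegral.integral_add (hh.intervalIntegrable _ _)
    (hk.intervalIntegrable _ _), smul_add]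
  rfl

theorem circleMean_smul (c : ℝ) (h : ℝ → E) :
    circleMean (fun s => c • h s) = c • circleMean h := by
  rw [circleMean, intervalIntegral.integral_smul, smul_comm]
  rfl

theorem oscillationPrimitive_sub {h k : ℝ → E} (hh : Continuous h) (hk : Continuous k) (x : ℝ) :
    oscillationPrimitive (fun s => h s - k s) x =
      oscillationPrimitive h x - oscillationPrimitive k x := by
  have hh' : Continuous fun s => h s - circleMean h := hh.sub continuous_const
  have hk' : Continuous fun s => k s - circleMean k := hk.sub continuous_const
  rw [oscillationPrimitive, oscillationPrimitive, oscillationPrimitive,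
    ← intervalIntegral.integral_sub (hh'.intervalIntegrable _ _)
    (hk'.intervalIntegrable _ _), circleMean_sub hh hk]
  simp only [sub_sub_sub_comm]

variable [CompleteSpace E]

theorem circleMean_const (x : E) : circleMean (fun _ => x) = x := by
  rw [circleMean, intervalIntegral.integral_const, sub_zero, smul_smul,
    inv_mul_cancel₀ Real.two_pi_pos.ne', one_smul]

theorem circleMean_clm {F : Type*} [NormedAddCommGroup F] [NormedSpace ℝ F] [CompleteSpace F]
    (A : E →L[ℝ] F) {h : ℝ → E} (hh : Continuous h) :
    circleMean (fun s => A (h s)) = A (circleMean h) := by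
  rw [circleMean, ContinuousLinearMap.intervalIntegral_comp_comm A (hh.intervalIntegrable _ _),
    ← map_smul]
  rfl

theorem hasDerivAt_oscillationPrimitive {h : ℝ → E} (hh : Continuous h) (x : ℝ) :
    HasDerivAt (oscillationPrimitive h) (h x - circleMean h) x :=
  intervalIntegral.integral_hasDerivAt_right
    ((hh.sub continuous_const).intervalIntegrable _ _)
    ((hh.sub continuous_const).stronglyMeasurableAtFilter _ _)
    (hh.sub continuous_const).continuousAt

theorem continuous_oscillationPrimitive {h : ℝ → E} (hh : Continuous h) :
    Continuous (oscillationPrimitive h) :=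
  continuous_iff_continuousAt.mpr fun x => (hasDerivAt_oscillationPrimitive hh x).continuousAt

theorem periodic_oscillationPrimitive {h : ℝ → E} (hh : Continuous h)
    (hper : Function.Periodic h (2 * Real.pi)) :
    Function.Periodic (oscillationPrimitive h) (2 * Real.pi) := by
  intro x
  have hc : Continuous fun s => h s - circleMean h := hh.sub continuous_const
  have hp : Function.Periodic (fun s => h s - circleMean h) (2 * Real.pi) := fun s => by
    simp only [hper s]
  have h1 := hp.intervalIntegral_add_eq x 0
  have h2 := circleMean_sub hh (continuous_const (y := circleMean h))
  rw [circleMean_const, sub_self, circleMean] at h2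
  have h3 := (smul_eq_zero.mp h2).resolve_left (inv_ne_zero Real.two_pi_pos.ne')
  rw [zero_add, h3] at h1
  rw [oscillationPrimitive, oscillationPrimitive, ← intervalIntegral.integral_add_adjacent_intervals
    (hc.intervalIntegrable 0 x) (hc.intervalIntegrable x _), h1, add_zero]

/-- By periodicity it suffices to integrate over at most one period, of length 2π, an integrand
bounded by 2G. -/
theorem norm_oscillationPrimitive_le {h : ℝ → E} (hh : Continuous h)
    (hper : Function.Periodic h (2 * Real.pi)) {G : ℝ} (hG : ∀ s, ‖h s‖ ≤ G) (x : ℝ) :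
    ‖oscillationPrimitive h x‖ ≤ 4 * Real.pi * G := by
  obtain ⟨y, hy, hxy⟩ := (periodic_oscillationPrimitive hh hper).exists_mem_Ico₀ Real.two_pi_pos x
  rw [hxy]
  have h1 := intervalIntegral.norm_integral_le_of_norm_le_const (a := 0) (b := y)
    (f := fun s => h s - circleMean h) (C := 2 * G)
    (fun s _ => (norm_sub_le _ _).trans (by linarith [hG s, norm_circleMean_le hG]))
  have hG0 : 0 ≤ G := (norm_nonneg _).trans (hG 0)
  rw [sub_zero, abs_of_nonneg hy.1] at h1
  refine h1.trans ?_
  nlinarith [mul_le_mul_of_nonneg_left hy.2.le hG0]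

/-- The primitive of `h - circleMean h` with mean zero. -/
noncomputable def periodicPrimitive (h : ℝ → E) (x : ℝ) : E :=
  oscillationPrimitive h x - circleMean (oscillationPrimitive h)

theorem hasDerivAt_periodicPrimitive {h : ℝ → E} (hh : Continuous h) (x : ℝ) :
    HasDerivAt (periodicPrimitive h) (h x - circleMean h) x :=
  (hasDerivAt_oscillationPrimitive hh x).sub_const _

theorem continuous_periodicPrimitive {h : ℝ → E} (hh : Continuous h) :
    Continuous (periodicPrimitive h) :=
  (continuous_oscillationPrimitive hh).sub continuous_const

theorem periodic_periodicPrimitive {h : ℝ → E} (hh : Continuous h)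
    (hper : Function.Periodic h (2 * Real.pi)) :
    Function.Periodic (periodicPrimitive h) (2 * Real.pi) := fun x => by
  rw [periodicPrimitive, periodic_oscillationPrimitive hh hper x]
  rfl

theorem norm_periodicPrimitive_le {h : ℝ → E} (hh : Continuous h)
    (hper : Function.Periodic h (2 * Real.pi)) {G : ℝ} (hG : ∀ s, ‖h s‖ ≤ G) (x : ℝ) :
    ‖periodicPrimitive h x‖ ≤ 8 * Real.pi * G := by
  have h1 := norm_oscillationPrimitive_le hh hper hG
  refine (norm_sub_le _ _).trans ?_
  linarith [h1 x, norm_circleMean_le h1]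

theorem periodicPrimitive_sub {h k : ℝ → E} (hh : Continuous h) (hk : Continuous k) (x : ℝ) :
    periodicPrimitive (fun s => h s - k s) x = periodicPrimitive h x - periodicPrimitive k x := by
  have : oscillationPrimitive (fun s => h s - k s) =
      fun x => oscillationPrimitive h x - oscillationPrimitive k x :=
    funext (oscillationPrimitive_sub hh hk)
  rw [periodicPrimitive, this, circleMean_sub (continuous_oscillationPrimitive hh)
    (continuous_oscillationPrimitive hk), periodicPrimitive, periodicPrimitive]
  exact sub_sub_sub_comm _ _ _ _

theorem circleMean_periodicPrimitive {h : ℝ → E} (hh : Continuous h) :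
    circleMean (periodicPrimitive h) = 0 := by
  have := circleMean_sub (continuous_oscillationPrimitive hh)
    (continuous_const (y := circleMean (oscillationPrimitive h)))
  rw [circleMean_const, sub_self] at this
  exact this

open BoundedContinuousFunction in
/-- A slowly varying periodic system that is close to an invertible linear one has a periodic
solution near the origin. -/
theorem exists_periodic_solution (A : E ≃L[ℝ] E) {H : E → ℝ → E} {r δ η ε : ℝ}
    (hH : ContinuousOn (fun p : E × ℝ => H p.1 p.2) (Metric.closedBall 0 r ×ˢ Set.univ))
    (hper : ∀ x ∈ Metric.closedBall (0 : E) r, Function.Periodic (H x) (2 * Real.pi))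
    (hlip : ∀ x ∈ Metric.closedBall (0 : E) r, ∀ y ∈ Metric.closedBall (0 : E) r, ∀ s,
      ‖H x s - H y s - A (x - y)‖ ≤ δ * ‖x - y‖)
    (h0 : ∀ s, ‖H 0 s‖ ≤ η) (hδ : 0 ≤ δ) (hε : 0 ≤ ε)
    (hcontr : ‖(A.symm : E →L[ℝ] E)‖ * δ + ε * (8 * Real.pi * (‖(A : E →L[ℝ] E)‖ + δ)) ≤ 1 / 2)
    (hsmall : 2 * ((‖(A.symm : E →L[ℝ] E)‖ + ε * (8 * Real.pi)) * η) ≤ r) :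
    ∃ y : ℝ → E, Function.Periodic y (2 * Real.pi) ∧
      (∀ s, HasDerivAt y (ε • H (y s) s) s) ∧
      ∀ s, ‖y s‖ ≤ 2 * ((‖(A.symm : E →L[ℝ] E)‖ + ε * (8 * Real.pi)) * η) := by
  set R := 2 * ((‖(A.symm : E →L[ℝ] E)‖ + ε * (8 * Real.pi)) * η) with hR
  have hη : 0 ≤ η := (norm_nonneg _).trans (h0 0)
  have hR0 : 0 ≤ R := by positivity
  set S : Set (ℝ →ᵇ E) := {y | Function.Periodic y (2 * Real.pi) ∧ ‖y‖ ≤ R} with hS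
  have hSclosed : IsClosed S := by
    have h1 : IsClosed {y : ℝ →ᵇ E | ∀ s, y (s + 2 * Real.pi) = y s} := by
      rw [Set.ofPred_forall]
      exact isClosed_iInter fun s =>
        isClosed_eq (continuous_eval_const _) (continuous_eval_const _)
    exact h1.inter (isClosed_le continuous_norm continuous_const)
  have : CompleteSpace S := hSclosed.completeSpace_coe
  have hball : ∀ (y : S) (s : ℝ), (y : ℝ →ᵇ E) s ∈ Metric.closedBall (0 : E) r := fun y s => by
    rw [mem_closedBall_zero_iff]
    exact ((norm_coe_le_norm _ s).trans y.2.2).trans hsmall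
  have h0mem : (0 : E) ∈ Metric.closedBall (0 : E) r := by
    simpa using hR0.trans hsmall
  set h : S → ℝ → E := fun y s => H ((y : ℝ →ᵇ E) s) s with hh
  have hcont : ∀ y : S, Continuous (h y) := fun y =>
    hH.comp_continuous ((y : ℝ →ᵇ E).continuous.prodMk continuous_id)
      fun s => ⟨hball y s, Set.mem_univ _⟩
  have hhper : ∀ y : S, Function.Periodic (h y) (2 * Real.pi) := fun y s => by
    simp only [hh, y.2.1 s]
    exact hper _ (hball y s) s
  set A' : E →L[ℝ] E := (A.symm : E →L[ℝ] E) with hA'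
  -- Lyapunov–Schmidt: the oscillation of y is prescribed by the equation y' = εH, and the mean is
  -- corrected by a Newton step with A⁻¹. The mean step carries no factor ε⁻¹.
  set Ψ : S → ℝ → E := fun y s =>
    circleMean (y : ℝ →ᵇ E) - A' (circleMean (h y)) + ε • periodicPrimitive (h y) s with hΨ
  -- Contraction estimate, for w a difference of two candidates and k the difference of their
  -- right-hand sides: A⁻¹ cancels the linear part of the mean, leaving only the defect k - Aw.
  have key : ∀ (w k : ℝ → E) (G : ℝ), Continuous w → Continuous k →
      Function.Periodic k (2 * Real.pi) → (∀ s, ‖w s‖ ≤ G) → (∀ s, ‖k s - A (w s)‖ ≤ δ * G) →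
      ∀ s, ‖circleMean w - A' (circleMean k) + ε • periodicPrimitive k s‖ ≤ 1 / 2 * G := by
    intro w k G hw hk hkper hwG hkG s
    have hG0 : 0 ≤ G := (norm_nonneg _).trans (hwG 0)
    have hkb : ∀ s, ‖k s‖ ≤ (‖(A : E →L[ℝ] E)‖ + δ) * G := fun s => by
      have h1 : ‖A (w s)‖ ≤ ‖(A : E →L[ℝ] E)‖ * G := (A : E →L[ℝ] E).le_opNorm_of_le (hwG s)
      have h2 := norm_add_le (k s - A (w s)) (A (w s))
      rw [sub_add_cancel] at h2
      linarith [hkG s]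
    have h1 : circleMean w - A' (circleMean k) = -A' (circleMean fun s => k s - A (w s)) := by
      have hAw : Continuous fun s => (A : E →L[ℝ] E) (w s) := by fun_prop
      rw [show (fun s => k s - A (w s)) = fun s => k s - (A : E →L[ℝ] E) (w s) from rfl,
        circleMean_sub hk hAw, circleMean_clm _ hw, map_sub, neg_sub]
      simp [hA']
    have h2 : ‖A' (circleMean fun s => k s - A (w s))‖ ≤ ‖A'‖ * (δ * G) :=
      A'.le_opNorm_of_le (norm_circleMean_le hkG)
    have h3 := norm_periodicPrimitive_le hk hkper hkb s
    rw [h1]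
    refine (norm_add_le _ _).trans ?_
    rw [norm_neg, norm_smul, Real.norm_of_nonneg hε]
    have h4 := mul_le_mul_of_nonneg_left h3 hε
    have h5 := mul_le_mul_of_nonneg_right hcontr hG0
    nlinarith
  have hdiff : ∀ (y z : S) s, ‖Ψ y s - Ψ z s‖ ≤ 1 / 2 * dist y z := by
    intro y z s
    have h1 := key (fun s => (y : ℝ →ᵇ E) s - (z : ℝ →ᵇ E) s) (fun s => h y s - h z s)
      (dist y z) ((y : ℝ →ᵇ E).continuous.sub (z : ℝ →ᵇ E).continuous)
      ((hcont y).sub (hcont z)) (fun s => by simp only [hhper y s, hhper z s])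
      (fun s => by rw [← dist_eq_norm]; exact dist_coe_le_dist s)
      (fun s => (hlip _ (hball y s) _ (hball z s) s).trans (by
        rw [← dist_eq_norm]
        exact mul_le_mul_of_nonneg_left (dist_coe_le_dist s) hδ)) s
    rw [circleMean_sub (y : ℝ →ᵇ E).continuous (z : ℝ →ᵇ E).continuous,
      circleMean_sub (hcont y) (hcont z), periodicPrimitive_sub (hcont y) (hcont z)] at h1
    refine le_trans (le_of_eq ?_) h1
    simp only [hΨ, map_sub, smul_sub]
    congr 1
    abel
  have hΨcont : ∀ y, Continuous (Ψ y) := fun y =>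
    continuous_const.add ((continuous_periodicPrimitive (hcont y)).const_smul ε)
  set z0 : S := ⟨0, fun s => rfl, by simpa using hR0⟩ with hz0
  have hΨ0 : ∀ s, ‖Ψ z0 s‖ ≤ R / 2 := by
    intro s
    have hk : ∀ s, ‖h z0 s‖ ≤ η := h0
    have h1 : circleMean (z0 : ℝ →ᵇ E) = 0 := circleMean_const (0 : E)
    have h2 := A'.le_opNorm_of_le (norm_circleMean_le hk)
    have h3 := mul_le_mul_of_nonneg_left
      (norm_periodicPrimitive_le (hcont z0) (hhper z0) hk s) hε
    simp only [hΨ, h1, zero_sub]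
    refine (norm_add_le _ _).trans ?_
    rw [norm_neg, norm_smul, Real.norm_of_nonneg hε, hR]
    linarith
  have hΨR : ∀ y s, ‖Ψ y s‖ ≤ R := fun y s => by
    have h1 := norm_add_le (Ψ y s - Ψ z0 s) (Ψ z0 s)
    rw [sub_add_cancel] at h1
    have h2 : dist y z0 ≤ R := by
      rw [Subtype.dist_eq, dist_zero_right]; exact y.2.2
    linarith [hdiff y z0 s, hΨ0 s]
  set f : S → S := fun y => ⟨ofNormedAddCommGroup (Ψ y) (hΨcont y) R (hΨR y), fun s => by
    change Ψ y (s + 2 * Real.pi) = Ψ y s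
    simp only [hΨ, periodic_periodicPrimitive (hcont y) (hhper y) s],
    norm_ofNormedAddCommGroup_le _ hR0 (hΨR y)⟩ with hf
  have hfΨ : ∀ y s, (f y : ℝ →ᵇ E) s = Ψ y s := fun y s => rfl
  have hcw : ContractingWith (1 / 2) f := by
    refine ⟨by norm_num, LipschitzWith.of_dist_le_mul fun y z => ?_⟩
    rw [Subtype.dist_eq, BoundedContinuousFunction.dist_le (by positivity)]
    intro s
    rw [hfΨ, hfΨ, dist_eq_norm]
    exact_mod_cast hdiff y z s
  have : Nonempty S := ⟨z0⟩
  set y := ContractingWith.fixedPoint f hcw with hy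
  have hfix : ∀ s, Ψ y s = (y : ℝ →ᵇ E) s := fun s => by
    rw [← hfΨ]
    exact congrArg (fun u : S => (u : ℝ →ᵇ E) s) hcw.fixedPoint_isFixedPt
  -- The periodic primitive has mean zero, so taking means in y = Ψ(y) forces A⁻¹ of the mean of h
  -- to vanish. Then differentiating Ψ(y) gives exactly εh.
  have hmean : circleMean (h y) = 0 := by
    have h1 : circleMean (Ψ y) = circleMean (y : ℝ →ᵇ E) := congrArg circleMean (funext hfix)
    have h2 : circleMean (Ψ y) = circleMean (y : ℝ →ᵇ E) - A' (circleMean (h y)) := by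
      have hQ : Continuous fun s => ε • periodicPrimitive (h y) s :=
        (continuous_periodicPrimitive (hcont y)).const_smul ε
      simp only [hΨ]
      rw [circleMean_add continuous_const hQ, circleMean_const,
        circleMean_smul, circleMean_periodicPrimitive (hcont y), smul_zero, add_zero]
    rw [h1] at h2
    have h3 : A' (circleMean (h y)) = 0 := by
      have := h2.symm
      rwa [sub_eq_self] at this
    exact A.symm.map_eq_zero_iff.mp h3
  refine ⟨(y : ℝ →ᵇ E), y.2.1, fun s => ?_, fun s => (norm_coe_le_norm _ s).trans y.2.2⟩
  have h1 := ((hasDerivAt_periodicPrimitive (hcont y) s).const_smul ε).const_add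
    (circleMean (y : ℝ →ᵇ E) - A' (circleMean (h y)))
  rw [hmean, sub_zero] at h1
  refine (h1.congr_deriv rfl).congr_of_eventuallyEq (Eventually.of_forall fun s => ?_)
  rw [← hfix s]
  simp only [hΨ, hmean]
  rfl

end PeriodicSolution

/-! ### Scalar phase equations -/

theorem surjective_of_half_le_deriv {x x' : ℝ → ℝ} (hx : ∀ t, HasDerivAt x (x' t) t)
    (hx' : ∀ t, 1 / 2 ≤ x' t) : Function.Surjective x := by
  have hmono : Monotone fun t => x t - 1 / 2 * t := by
    refine monotone_of_hasDerivAt_nonneg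
      (fun t => (hx t).sub ((hasDerivAt_id t).const_mul (1 / 2))) fun t => ?_
    change 0 ≤ x' t - 1 / 2 * 1
    linarith [hx' t]
  have hc : Continuous x := continuous_iff_continuousAt.mpr fun t => (hx t).continuousAt
  refine hc.surjective ?_ ?_
  · refine tendsto_atTop_mono' _ ?_
      (tendsto_atTop_add_const_right _ (x 0) (tendsto_id.const_mul_atTop (one_half_pos (α := ℝ))))
    filter_upwards [eventually_ge_atTop 0] with t ht
    have := hmono ht
    simp only [id] at this ⊢
    linarith
  · refine tendsto_atBot_mono' _ ?_
      (tendsto_atBot_add_const_right _ (x 0) (tendsto_id.const_mul_atBot (one_half_pos (α := ℝ))))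
    filter_upwards [eventually_le_atBot 0] with t ht
    have := hmono ht
    simp only [id] at this ⊢
    linarith

/-- An autonomous scalar equation on the circle with speed close to one. -/
theorem exists_phase {g : ℝ → ℝ} {η : ℝ} (hg : Continuous g)
    (hper : Function.Periodic g (2 * Real.pi)) (hη : η ≤ 1 / 2) (hg1 : ∀ s, |g s - 1| ≤ η) :
    ∃ (x : ℝ → ℝ) (T : ℝ), x 0 = 0 ∧ 0 < T ∧ |T - 2 * Real.pi| ≤ 4 * Real.pi * η ∧
      (∀ t, HasDerivAt x (g (x t)) t) ∧ ∀ t, x (t + T) = x t + 2 * Real.pi := by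
  have hgb : ∀ s, 1 / 2 ≤ g s ∧ g s ≤ 3 / 2 := fun s => by
    have := abs_le.mp (hg1 s)
    constructor <;> linarith
  have hgpos : ∀ s, 0 < g s := fun s => by linarith [hgb s]
  have hinv : Continuous fun s => (g s)⁻¹ := hg.inv₀ fun s => (hgpos s).ne'
  -- τ(u) is the time at which phase u is reached. Its inverse is the solution, and the period is
  -- τ(2π).
  set τ : ℝ → ℝ := fun u => ∫ s in (0 : ℝ)..u, (g s)⁻¹ with hτ
  have hτd : ∀ u, HasDerivAt τ (g u)⁻¹ u := fun u =>
    intervalIntegral.integral_hasDerivAt_right (hinv.intervalIntegrable _ _)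
      (hinv.stronglyMeasurableAtFilter _ _) hinv.continuousAt
  have hτ0 : τ 0 = 0 := intervalIntegral.integral_same
  have hmono : StrictMono τ := strictMono_of_hasDerivAt_pos hτd fun u => inv_pos.mpr (hgpos u)
  have hsurj : Function.Surjective τ := surjective_of_half_le_deriv hτd fun u => by
    have : (3 / 2 : ℝ)⁻¹ ≤ (g u)⁻¹ := inv_anti₀ (hgpos u) (hgb u).2
    norm_num at this
    linarith
  set e := hmono.orderIsoOfSurjective τ hsurj with he
  have hτe : ∀ t, τ (e.symm t) = t := fun t => e.apply_symm_apply t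
  have heτ : ∀ t, e.symm (τ t) = t := fun t => e.symm_apply_apply t
  have hadd : ∀ u, τ (u + 2 * Real.pi) = τ u + τ (2 * Real.pi) := fun u => by
    have hp : Function.Periodic (fun s => (g s)⁻¹) (2 * Real.pi) := fun s => by
      simp only [hper s]
    have := hp.intervalIntegral_add_eq u 0
    rw [zero_add] at this
    simp only [hτ]
    rw [← this, intervalIntegral.integral_add_adjacent_intervals
      (hinv.intervalIntegrable _ _) (hinv.intervalIntegrable _ _)]
  refine ⟨e.symm, τ (2 * Real.pi), ?_, ?_, ?_, fun t => ?_, fun t => ?_⟩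
  · simpa only [hτ0] using heτ 0
  · rw [← hτ0]; exact hmono Real.two_pi_pos
  · have h1 := intervalIntegral.norm_integral_le_of_norm_le_const (a := 0) (b := 2 * Real.pi)
      (f := fun s => (g s)⁻¹ - 1) (C := 2 * η) (fun s _ => by
        rw [Real.norm_eq_abs, show (g s)⁻¹ - 1 = -(g s - 1) * (g s)⁻¹ by
          field_simp [(hgpos s).ne']; ring, abs_mul, abs_neg, abs_of_pos (inv_pos.mpr (hgpos s)),
          mul_comm 2]
        refine mul_le_mul (hg1 s) ?_ (inv_pos.mpr (hgpos s)).le ((abs_nonneg _).trans (hg1 s))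
        have : (g s)⁻¹ ≤ (1 / 2)⁻¹ := inv_anti₀ (by norm_num) (hgb s).1
        norm_num at this ⊢
        exact this)
    rw [intervalIntegral.integral_sub (hinv.intervalIntegrable _ _)
      (continuous_const.intervalIntegrable _ _), intervalIntegral.integral_const, sub_zero,
      abs_of_pos Real.two_pi_pos, smul_eq_mul, mul_one, Real.norm_eq_abs] at h1
    refine h1.trans (le_of_eq ?_)
    ring
  · have := HasDerivAt.of_local_left_inverse (e.symm.continuous.continuousAt (x := t))
      (hτd (e.symm t)) (inv_ne_zero (hgpos _).ne') (Eventually.of_forall hτe)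
    rwa [inv_inv] at this
  · apply hmono.injective
    rw [hadd, hτe, hτe]

/-! ### The reduced slow equation near the equilibrium -/

namespace SlowFast

variable {n : ℕ}

/-- The field `(0, 1) + ε F + ε² W`, with the slow and the fast components bundled. -/
noncomputable def bundledField (F : Slow n → Lifted n) (W : Lifted n → Lifted n) (ε : ℝ)
    (p : Lifted n) : Lifted n :=
  (0, 1) + ε • F p.1 + ε ^ 2 • W p

theorem fullField_eq_bundledField (F₁ : Slow n → Slow n) (G₁ : Slow n → ℝ)
    (F₂ : Slow n → ℝ → Slow n) (G₂ : Slow n → ℝ → ℝ) (ε : ℝ) :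
    fullField F₁ G₁ F₂ G₂ ε =
      bundledField (fun χ => (F₁ χ, G₁ χ)) (fun p => (F₂ p.1 p.2, G₂ p.1 p.2)) ε := by
  funext p
  ext <;> simp [fullField, bundledField]

/-- Uniform bounds near `χ₀` on the coefficients of a bundled field. -/
structure IsControlled (F : Slow n → Lifted n) (W : Lifted n → Lifted n) (χ₀ : Slow n)
    (r K : ℝ) : Prop where
  r_pos : 0 < r
  K_nonneg : 0 ≤ K
  differentiableAt_slow : ∀ χ ∈ Metric.closedBall χ₀ r, DifferentiableAt ℝ F χ
  norm_slow_le : ∀ χ ∈ Metric.closedBall χ₀ r, ‖F χ‖ ≤ K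
  norm_fderiv_slow_le : ∀ χ ∈ Metric.closedBall χ₀ r, ‖fderiv ℝ F χ‖ ≤ K
  norm_fderiv_slow_sub_le :
    ∀ χ ∈ Metric.closedBall χ₀ r, ‖fderiv ℝ F χ - fderiv ℝ F χ₀‖ ≤ K * ‖χ - χ₀‖
  continuousOn_fderiv_slow : ContinuousOn (fderiv ℝ F) (Metric.closedBall χ₀ r)
  differentiableAt : ∀ p : Lifted n, p.1 ∈ Metric.closedBall χ₀ r → DifferentiableAt ℝ W p
  norm_le : ∀ p : Lifted n, p.1 ∈ Metric.closedBall χ₀ r → ‖W p‖ ≤ K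
  norm_fderiv_le : ∀ p : Lifted n, p.1 ∈ Metric.closedBall χ₀ r → ‖fderiv ℝ W p‖ ≤ K
  continuousOn_fderiv : ContinuousOn (fderiv ℝ W) (Metric.closedBall χ₀ r ×ˢ Set.univ)
  periodic : ∀ χ ∈ Metric.closedBall χ₀ r, Function.Periodic (fun s => W (χ, s)) (2 * Real.pi)

namespace IsControlled

variable {F : Slow n → Lifted n} {W : Lifted n → Lifted n} {χ₀ : Slow n} {r K : ℝ}

/-- This makes the truncated system a special case of the full one, with the same r and K. -/
theorem zero_right (h : IsControlled F W χ₀ r K) : IsControlled F (fun _ => 0) χ₀ r K where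
  r_pos := h.r_pos
  K_nonneg := h.K_nonneg
  differentiableAt_slow := h.differentiableAt_slow
  norm_slow_le := h.norm_slow_le
  norm_fderiv_slow_le := h.norm_fderiv_slow_le
  norm_fderiv_slow_sub_le := h.norm_fderiv_slow_sub_le
  continuousOn_fderiv_slow := h.continuousOn_fderiv_slow
  differentiableAt := fun _ _ => differentiableAt_const _
  norm_le := fun _ _ => by simpa using h.K_nonneg
  norm_fderiv_le := fun _ _ => by simpa using h.K_nonneg
  continuousOn_fderiv :=
    (continuousOn_const (c := (0 : Lifted n →L[ℝ] Lifted n))).congr fun _ _ => by simp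
  periodic := fun _ _ _ => rfl

theorem norm_slow_sub_le (h : IsControlled F W χ₀ r K) {ρ : ℝ} (hρ : ρ ≤ r) {x y : Slow n}
    (hx : x ∈ Metric.closedBall χ₀ ρ) (hy : y ∈ Metric.closedBall χ₀ ρ) :
    ‖F x - F y - fderiv ℝ F χ₀ (x - y)‖ ≤ K * ρ * ‖x - y‖ := by
  have hsub := Metric.closedBall_subset_closedBall (x := χ₀) hρ
  refine (convex_closedBall χ₀ ρ).norm_image_sub_le_of_norm_hasFDerivWithin_le'
    (fun z hz => (h.differentiableAt_slow z (hsub hz)).hasFDerivAt.hasFDerivWithinAt)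
    (fun z hz => ?_) hy hx
  refine (h.norm_fderiv_slow_sub_le z (hsub hz)).trans ?_
  rw [mem_closedBall_iff_norm] at hz
  exact mul_le_mul_of_nonneg_left hz h.K_nonneg

theorem norm_fast_sub_le (h : IsControlled F W χ₀ r K) {x y : Slow n}
    (hx : x ∈ Metric.closedBall χ₀ r) (hy : y ∈ Metric.closedBall χ₀ r) (s : ℝ) :
    ‖W (x, s) - W (y, s)‖ ≤ K * ‖x - y‖ := by
  have hc : Convex ℝ (Metric.closedBall χ₀ r ×ˢ (Set.univ : Set ℝ)) :=
    (convex_closedBall χ₀ r).prod convex_univ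
  have := hc.norm_image_sub_le_of_norm_fderiv_le (𝕜 := ℝ)
    (fun z hz => h.differentiableAt z hz.1) (fun z hz => h.norm_fderiv_le z hz.1)
    (x := (y, s)) (y := (x, s)) ⟨hy, Set.mem_univ _⟩ ⟨hx, Set.mem_univ _⟩
  refine this.trans (le_of_eq ?_)
  simp [Prod.norm_def]

theorem differentiableAt_bundledField (h : IsControlled F W χ₀ r K) (ε : ℝ) {p : Lifted n}
    (hp : p.1 ∈ Metric.closedBall χ₀ r) : DifferentiableAt ℝ (bundledField F W ε) p := by
  have h1 : DifferentiableAt ℝ (fun p : Lifted n => F p.1) p :=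
    (h.differentiableAt_slow _ hp).comp p differentiableAt_fst
  exact ((h1.fun_const_smul ε).const_add _).add ((h.differentiableAt p hp).fun_const_smul _)

theorem bundledField_periodic (h : IsControlled F W χ₀ r K) (ε : ℝ) {x : Slow n}
    (hx : x ∈ Metric.closedBall χ₀ r) (s : ℝ) :
    bundledField F W ε (x, s + 2 * Real.pi) = bundledField F W ε (x, s) := by
  have := h.periodic x hx s
  simp only [bundledField] at this ⊢
  rw [this]

theorem continuousOn_bundledField (h : IsControlled F W χ₀ r K) (ε : ℝ) :
    ContinuousOn (bundledField F W ε) (Metric.closedBall χ₀ r ×ˢ Set.univ) :=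
  fun _ hp => (h.differentiableAt_bundledField ε hp.1).continuousAt.continuousWithinAt

theorem norm_bundledField_sub_le (h : IsControlled F W χ₀ r K) {ε : ℝ} (hε : 0 ≤ ε) (hε1 : ε ≤ 1)
    {p : Lifted n} (hp : p.1 ∈ Metric.closedBall χ₀ r) :
    ‖bundledField F W ε p - (0, 1)‖ ≤ 2 * K * ε := by
  have h1 : bundledField F W ε p - (0, 1) = ε • F p.1 + ε ^ 2 • W p := by
    simp only [bundledField]; abel
  rw [h1]
  refine (norm_add_le _ _).trans ?_
  rw [norm_smul, norm_smul, norm_pow, Real.norm_of_nonneg hε]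
  have h2 := mul_le_mul_of_nonneg_left (h.norm_slow_le _ hp) hε
  have h3 := mul_le_mul_of_nonneg_left (h.norm_le _ hp) (sq_nonneg ε)
  have h4 : ε ^ 2 * K ≤ ε * K := mul_le_mul_of_nonneg_right (by nlinarith) h.K_nonneg
  linarith

theorem norm_bundledField_fst_le (h : IsControlled F W χ₀ r K) {ε : ℝ} (hε : 0 ≤ ε) (hε1 : ε ≤ 1)
    {p : Lifted n} (hp : p.1 ∈ Metric.closedBall χ₀ r) :
    ‖(bundledField F W ε p).1‖ ≤ 2 * K * ε := by
  have := (norm_fst_le _).trans (h.norm_bundledField_sub_le hε hε1 hp)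
  simpa using this

theorem abs_bundledField_snd_sub_le (h : IsControlled F W χ₀ r K) {ε : ℝ} (hε : 0 ≤ ε)
    (hε1 : ε ≤ 1) {p : Lifted n} (hp : p.1 ∈ Metric.closedBall χ₀ r) :
    |(bundledField F W ε p).2 - 1| ≤ 2 * K * ε := by
  have := (norm_snd_le _).trans (h.norm_bundledField_sub_le hε hε1 hp)
  simpa using this

theorem half_le_bundledField_snd (h : IsControlled F W χ₀ r K) {ε : ℝ} (hε : 0 ≤ ε)
    (hε1 : ε ≤ 1) (hKε : 2 * K * ε ≤ 1 / 2) {p : Lifted n} (hp : p.1 ∈ Metric.closedBall χ₀ r) :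
    1 / 2 ≤ (bundledField F W ε p).2 := by
  have := abs_le.mp (h.abs_bundledField_snd_sub_le hε hε1 hp)
  linarith

theorem norm_bundledField_sub_sub_le (h : IsControlled F W χ₀ r K) {ε : ℝ} (hε : 0 ≤ ε)
    {ρ : ℝ} (hρ : ρ ≤ r) {x y : Slow n} (hx : x ∈ Metric.closedBall χ₀ ρ)
    (hy : y ∈ Metric.closedBall χ₀ ρ) (s : ℝ) :
    ‖bundledField F W ε (x, s) - bundledField F W ε (y, s) - ε • fderiv ℝ F χ₀ (x - y)‖ ≤
      ε * ((K * ρ + ε * K) * ‖x - y‖) := by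
  have hsub := Metric.closedBall_subset_closedBall (x := χ₀) hρ
  have h1 : bundledField F W ε (x, s) - bundledField F W ε (y, s) - ε • fderiv ℝ F χ₀ (x - y) =
      ε • (F x - F y - fderiv ℝ F χ₀ (x - y)) + ε ^ 2 • (W (x, s) - W (y, s)) := by
    simp only [bundledField]
    module
  rw [h1]
  refine (norm_add_le _ _).trans ?_
  rw [norm_smul, norm_smul, norm_pow, Real.norm_of_nonneg hε]
  have h2 := mul_le_mul_of_nonneg_left (h.norm_slow_sub_le hρ hx hy) hε
  have h3 := mul_le_mul_of_nonneg_left (h.norm_fast_sub_le (hsub hx) (hsub hy) s) (sq_nonneg ε)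
  linarith

/-- Comparison of the slow velocities at two points of the same phase, after rescaling time so that
the fast velocities agree. -/
theorem norm_slow_velocity_sub_le (h : IsControlled F W χ₀ r K) {ε : ℝ} (hε : 0 ≤ ε)
    (hε1 : ε ≤ 1) (hKε : 2 * K * ε ≤ 1 / 2) {ρ : ℝ} (hρ : ρ ≤ r) (hρ1 : ρ ≤ 1) {x y : Slow n}
    (hx : x ∈ Metric.closedBall χ₀ ρ) (hy : y ∈ Metric.closedBall χ₀ ρ) (s : ℝ) :
    ‖(bundledField F W ε (x, s)).1 - ((bundledField F W ε (x, s)).2 /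
        (bundledField F W ε (y, s)).2) • (bundledField F W ε (y, s)).1 -
        ε • (fderiv ℝ F χ₀ (x - y)).1‖ ≤
      ε * ((K * ρ + ε * (K + 12 * K ^ 2)) * ‖x - y‖) := by
  have hsub := Metric.closedBall_subset_closedBall (x := χ₀) hρ
  have hχ₀ : χ₀ ∈ Metric.closedBall χ₀ r := Metric.mem_closedBall_self h.r_pos.le
  have hK := h.K_nonneg
  have h1 := h.norm_bundledField_sub_sub_le hε hρ hx hy s
  set X₁ := bundledField F W ε (x, s)
  set X₂ := bundledField F W ε (y, s)
  have hX₂ : 1 / 2 ≤ X₂.2 := h.half_le_bundledField_snd hε hε1 hKε (hsub hy)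
  have hX₂0 : X₂.2 ≠ 0 := by linarith
  have hX₂1 : ‖X₂.1‖ ≤ 2 * K * ε := h.norm_bundledField_fst_le hε hε1 (hsub hy)
  have h2 : ‖X₁.1 - X₂.1 - ε • (fderiv ℝ F χ₀ (x - y)).1‖ ≤
      ε * ((K * ρ + ε * K) * ‖x - y‖) := (norm_fst_le _).trans h1
  have h3 : |X₁.2 - X₂.2| ≤ ε * (3 * K * ‖x - y‖) := by
    have h4 : ‖X₁ - X₂‖ ≤ ε * (3 * K * ‖x - y‖) := by
      have h5 := norm_add_le (X₁ - X₂ - ε • fderiv ℝ F χ₀ (x - y)) (ε • fderiv ℝ F χ₀ (x - y))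
      rw [sub_add_cancel, norm_smul, Real.norm_of_nonneg hε] at h5
      have h6 := (fderiv ℝ F χ₀).le_of_opNorm_le (h.norm_fderiv_slow_le χ₀ hχ₀) (x - y)
      have h7 := mul_le_mul_of_nonneg_left h6 hε
      have h8 : ε * ((K * ρ + ε * K) * ‖x - y‖) ≤ ε * ((K + K) * ‖x - y‖) := by
        gcongr
        · nlinarith
        · nlinarith
      linarith
    exact (norm_snd_le _).trans h4
  -- The rescaling correction is a product of two factors of order ε, the difference of the fast
  -- speeds (3Kε‖x - y‖, doubled by 1/`X₂.2`) and the slow velocity (2Kε); hence the term 12K²ε².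
  have h4 : X₁.1 - (X₁.2 / X₂.2) • X₂.1 - ε • (fderiv ℝ F χ₀ (x - y)).1 =
      (X₁.1 - X₂.1 - ε • (fderiv ℝ F χ₀ (x - y)).1) - ((X₁.2 - X₂.2) / X₂.2) • X₂.1 := by
    rw [sub_div, div_self hX₂0]
    module
  rw [h4]
  refine (norm_sub_le _ _).trans ?_
  have h5 : ‖((X₁.2 - X₂.2) / X₂.2) • X₂.1‖ ≤ ε * (3 * K * ‖x - y‖) * 2 * (2 * K * ε) := by
    rw [norm_smul, Real.norm_eq_abs, abs_div]
    refine mul_le_mul ?_ hX₂1 (norm_nonneg _) (by positivity)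
    rw [abs_of_pos (show 0 < X₂.2 by linarith), div_le_iff₀ (by linarith)]
    have : 0 ≤ ε * (3 * K * ‖x - y‖) := by positivity
    nlinarith
  linarith

/-- The reduced slow equation, with the fast phase as independent variable. -/
theorem exists_reduced_periodic_solution (h : IsControlled F W χ₀ r K) (hF : (F χ₀).1 = 0)
    (A : Slow n ≃L[ℝ] Slow n) (hA : ∀ x, A x = (fderiv ℝ F χ₀ x).1) :
    ∃ C, 0 ≤ C ∧ ∀ᶠ ε in 𝓝[>] (0 : ℝ), ∃ y : ℝ → Slow n, Function.Periodic y (2 * Real.pi) ∧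
      (∀ s, y s ∈ Metric.closedBall χ₀ (C * ε)) ∧
      ∀ s, HasDerivAt y
        (((bundledField F W ε (y s, s)).2)⁻¹ • (bundledField F W ε (y s, s)).1) s := by
  have hK := h.K_nonneg
  set a := ‖(A : Slow n →L[ℝ] Slow n)‖ with ha
  set b := ‖(A.symm : Slow n →L[ℝ] Slow n)‖ with hb
  have ha0 : 0 ≤ a := norm_nonneg _
  have hb0 : 0 ≤ b := norm_nonneg _
  -- The term b·2Kρ is the only part of the contraction constant that does not vanish with ε, so ρ
  -- is fixed before ε.
  obtain ⟨ρ, hρ0, hρr, hρ1, hρb⟩ : ∃ ρ > 0, ρ ≤ r ∧ ρ ≤ 1 ∧ b * (2 * (K * ρ)) ≤ 1 / 8 := by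
    have h1 : Tendsto (fun ρ : ℝ => b * (2 * (K * ρ))) (𝓝[>] 0) (𝓝 0) := by
      have : Continuous fun ρ : ℝ => b * (2 * (K * ρ)) := by fun_prop
      simpa using (this.tendsto 0).mono_left nhdsWithin_le_nhds
    have h2 : ∀ᶠ ρ : ℝ in 𝓝[>] 0, 0 < ρ := self_mem_nhdsWithin
    have h3 : ∀ᶠ ρ : ℝ in 𝓝[>] 0, ρ ≤ r :=
      (eventually_le_nhds h.r_pos).filter_mono nhdsWithin_le_nhds
    have h4 : ∀ᶠ ρ : ℝ in 𝓝[>] 0, ρ ≤ 1 :=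
      (eventually_le_nhds one_pos).filter_mono nhdsWithin_le_nhds
    obtain ⟨ρ, hρ⟩ := (h2.and (h3.and (h4.and
      (h1.eventually_le_const (show (0 : ℝ) < 1 / 8 by norm_num))))).exists
    exact ⟨ρ, hρ.1, hρ.2.1, hρ.2.2.1, hρ.2.2.2⟩
  set C := 2 * ((b + 8 * Real.pi) * (2 * K)) with hC
  have hC0 : 0 ≤ C := by positivity
  refine ⟨C, hC0, ?_⟩
  have hev : ∀ {f : ℝ → ℝ} {c : ℝ}, Continuous f → f 0 < c → ∀ᶠ ε in 𝓝[>] (0 : ℝ), f ε ≤ c :=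
    fun hf hc => ((hf.tendsto 0).eventually_le_const hc).filter_mono nhdsWithin_le_nhds
  have e1 : ∀ᶠ ε : ℝ in 𝓝[>] 0, ε ≤ 1 := hev continuous_id one_pos
  have e2 : ∀ᶠ ε : ℝ in 𝓝[>] 0, 2 * K * ε ≤ 1 / 2 := hev (by fun_prop) (by norm_num)
  have e3 : ∀ᶠ ε : ℝ in 𝓝[>] 0, C * ε ≤ ρ := hev (by fun_prop) (by simpa using hρ0)
  have e4 : ∀ᶠ ε : ℝ in 𝓝[>] 0,
      b * (2 * (K * ρ + ε * (K + 12 * K ^ 2)) + 4 * K * ε * a) + ε * (8 * Real.pi *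
        (a + (2 * (K * ρ + ε * (K + 12 * K ^ 2)) + 4 * K * ε * a))) ≤ 1 / 2 := by
    refine hev (by fun_prop) ?_
    simp only [zero_mul, add_zero, mul_zero]
    linarith
  filter_upwards [e1, e2, e3, e4, self_mem_nhdsWithin] with ε hε1 hKε hCε hcontr hε
  have hε : 0 < ε := hε
  set Y : Slow n → ℝ → Lifted n := fun x s => bundledField F W ε (χ₀ + x, s) with hY
  have hmem : ∀ x ∈ Metric.closedBall (0 : Slow n) ρ, χ₀ + x ∈ Metric.closedBall χ₀ ρ :=
    fun x hx => by simpa using hx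
  have hmemr : ∀ x ∈ Metric.closedBall (0 : Slow n) ρ, χ₀ + x ∈ Metric.closedBall χ₀ r :=
    fun x hx => Metric.closedBall_subset_closedBall hρr (hmem x hx)
  have hYpos : ∀ x ∈ Metric.closedBall (0 : Slow n) ρ, ∀ s, 1 / 2 ≤ (Y x s).2 := fun x hx s =>
    h.half_le_bundledField_snd hε.le hε1 hKε (hmemr x hx)
  have h0mem : (0 : Slow n) ∈ Metric.closedBall (0 : Slow n) ρ := by simpa using hρ0.le
  have hYcont : ContinuousOn (fun p : Slow n × ℝ => Y p.1 p.2)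
      (Metric.closedBall 0 ρ ×ˢ Set.univ) :=
    (h.continuousOn_bundledField ε).comp
      ((continuous_const.add continuous_fst).prodMk continuous_snd).continuousOn
      fun p hp => ⟨hmemr p.1 hp.1, Set.mem_univ _⟩
  have hinv : ∀ x ∈ Metric.closedBall (0 : Slow n) ρ, ∀ s,
      0 < (Y x s).2 ∧ (Y x s).2⁻¹ ≤ 2 ∧ |(Y x s).2⁻¹ - 1| ≤ 4 * K * ε := fun x hx s => by
    have h1 := hYpos x hx s
    have h2 : 0 < (Y x s).2 := by linarith
    have h3 : (Y x s).2⁻¹ ≤ 2 := by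
      have := inv_anti₀ (by norm_num) h1
      norm_num at this
      exact this
    refine ⟨h2, h3, ?_⟩
    have h4 : |(Y x s).2 - 1| ≤ 2 * K * ε := h.abs_bundledField_snd_sub_le hε.le hε1 (hmemr x hx)
    have h5 : (Y x s).2⁻¹ - 1 = -((Y x s).2 - 1) * (Y x s).2⁻¹ := by
      field_simp
      ring
    rw [h5, abs_mul, abs_neg, abs_of_pos (inv_pos.mpr h2)]
    have := mul_le_mul h4 h3 (inv_pos.mpr h2).le (by positivity)
    linarith
  -- Here εH is dχ/dθ in coordinates centred at χ₀. In δ, the factor 2 bounds the inverse fast speed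
  -- and 4Kεa accounts for its deviation from 1. As F₁(χ₀) = 0, the slow velocity at χ₀ is of order
  -- ε², whence η = 2Kε.
  obtain ⟨y, hyper, hyd, hyle⟩ := exists_periodic_solution A
    (H := fun x s => (ε * (Y x s).2)⁻¹ • (Y x s).1) (r := ρ)
    (δ := 2 * (K * ρ + ε * (K + 12 * K ^ 2)) + 4 * K * ε * a) (η := 2 * K * ε) (ε := ε)
    (by
      have hm : ContinuousOn (fun p : Slow n × ℝ => ε * (Y p.1 p.2).2)
          (Metric.closedBall 0 ρ ×ˢ Set.univ) := continuousOn_const.mul hYcont.snd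
      exact (hm.inv₀ fun p hp => mul_ne_zero hε.ne' (hinv p.1 hp.1 p.2).1.ne').smul hYcont.fst)
    (fun x hx s => by simp only [hY, h.bundledField_periodic ε (hmemr x hx) s])
    (fun x hx z hz s => by
      have h1 := h.norm_slow_velocity_sub_le hε.le hε1 hKε hρr hρ1 (hmem x hx) (hmem z hz) s
      rw [add_sub_add_left_eq_sub, ← hA] at h1
      change ‖(Y x s).1 - ((Y x s).2 / (Y z s).2) • (Y z s).1 - ε • A (x - z)‖ ≤ _ at h1
      obtain ⟨hx0, hx2, hx3⟩ := hinv x hx s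
      have hz0 := (hinv z hz s).1
      have h2 : (ε * (Y x s).2)⁻¹ • (Y x s).1 - (ε * (Y z s).2)⁻¹ • (Y z s).1 - A (x - z) =
          (ε * (Y x s).2)⁻¹ • ((Y x s).1 - ((Y x s).2 / (Y z s).2) • (Y z s).1 - ε • A (x - z)) +
            ((Y x s).2⁻¹ - 1) • A (x - z) := by
        have e1 : (ε * (Y x s).2)⁻¹ * ((Y x s).2 / (Y z s).2) = (ε * (Y z s).2)⁻¹ := by
          field_simp
        have e2 : (ε * (Y x s).2)⁻¹ * ε = (Y x s).2⁻¹ := by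
          field_simp
        rw [smul_sub, smul_sub, smul_smul, smul_smul, e1, e2]
        module
      rw [h2]
      refine (norm_add_le _ _).trans ?_
      rw [norm_smul, norm_smul, Real.norm_of_nonneg (by positivity), Real.norm_eq_abs, mul_inv]
      have h3 : ‖A (x - z)‖ ≤ a * ‖x - z‖ := (A : Slow n →L[ℝ] Slow n).le_opNorm _
      have h4 := mul_le_mul hx3 h3 (norm_nonneg _) (by positivity)
      have h5 : ε⁻¹ * (Y x s).2⁻¹ * ‖(Y x s).1 - ((Y x s).2 / (Y z s).2) • (Y z s).1 -
          ε • A (x - z)‖ ≤ ε⁻¹ * 2 * (ε * ((K * ρ + ε * (K + 12 * K ^ 2)) * ‖x - z‖)) := by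
        gcongr
      have h6 : ε⁻¹ * 2 * (ε * ((K * ρ + ε * (K + 12 * K ^ 2)) * ‖x - z‖)) =
          2 * ((K * ρ + ε * (K + 12 * K ^ 2)) * ‖x - z‖) := by
        field_simp
      linarith)
    (fun s => by
      obtain ⟨hx0, hx2, hx3⟩ := hinv 0 h0mem s
      have h1 : (Y 0 s).1 = ε ^ 2 • (W (χ₀, s)).1 := by
        simp [hY, bundledField, hF]
      have h2 : ‖(W (χ₀, s)).1‖ ≤ K :=
        (norm_fst_le _).trans (h.norm_le _ (Metric.mem_closedBall_self h.r_pos.le))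
      rw [h1, smul_smul, norm_smul, Real.norm_of_nonneg (by positivity)]
      have h3 : (ε * (Y 0 s).2)⁻¹ * ε ^ 2 = (Y 0 s).2⁻¹ * ε := by
        field_simp
      rw [h3]
      have := mul_le_mul (mul_le_mul_of_nonneg_right hx2 hε.le) h2 (norm_nonneg _) (by positivity)
      linarith)
    (by positivity) hε.le hcontr (by
      refine le_trans ?_ hCε
      have : ε * (8 * Real.pi) ≤ 8 * Real.pi := by nlinarith [Real.pi_pos]
      have h2 := mul_le_mul_of_nonneg_right (add_le_add_right this b)
        (show 0 ≤ 2 * K * ε by positivity)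
      rw [hC]
      linarith)
  have hyle' : ∀ s, ‖y s‖ ≤ C * ε := fun s => by
    refine (hyle s).trans ?_
    have : ε * (8 * Real.pi) ≤ 8 * Real.pi := by nlinarith [Real.pi_pos]
    have h2 := mul_le_mul_of_nonneg_right (add_le_add_right this b)
      (show 0 ≤ 2 * K * ε by positivity)
    rw [hC]
    linarith
  refine ⟨fun s => χ₀ + y s, fun s => by simp only [hyper s], fun s => ?_, fun s => ?_⟩
  · simpa using hyle' s
  · refine ((hyd s).const_add χ₀).congr_deriv ?_
    rw [smul_smul]
    congr 1
    rw [mul_inv, mul_inv_cancel_left₀ hε.ne']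

end IsControlled

/-! ### From periodic graphs to limit cycles -/

theorem hasDerivAt_fst {γ : ℝ → Lifted n} {v : Lifted n} {t : ℝ} (h : HasDerivAt γ v t) :
    HasDerivAt (fun t => (γ t).1) v.1 t :=
  (ContinuousLinearMap.fst ℝ (Slow n) ℝ).hasFDerivAt.comp_hasDerivAt t h

theorem hasDerivAt_snd {γ : ℝ → Lifted n} {v : Lifted n} {t : ℝ} (h : HasDerivAt γ v t) :
    HasDerivAt (fun t => (γ t).2) v.2 t :=
  (ContinuousLinearMap.snd ℝ (Slow n) ℝ).hasFDerivAt.comp_hasDerivAt t h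

theorem proj_mem_orbit (γ : ℝ → Lifted n) (t : ℝ) : proj (γ t) ∈ orbit γ :=
  Set.mem_range.mpr ⟨t, rfl⟩

theorem orbit_eq_range_graph {γ : ℝ → Lifted n} {y : ℝ → Slow n}
    (hγ : ∀ t, (γ t).1 = y (γ t).2) (hsurj : Function.Surjective fun t => (γ t).2) :
    orbit γ = Set.range fun s => proj (y s, s) := by
  ext c
  constructor
  · rintro ⟨t, rfl⟩
    exact ⟨(γ t).2, by simp only [proj, hγ t]⟩
  · rintro ⟨s, rfl⟩
    obtain ⟨t, rfl⟩ := hsurj s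
    exact ⟨t, by simp only [proj, hγ t]⟩

/-- A closed orbit obtained by following the graph of a periodic function of the phase. -/
theorem exists_isClosedOrbit_of_graph {X : Lifted n → Lifted n} {D : Set (Lifted n)}
    {y : ℝ → Slow n} {η : ℝ} (hyper : Function.Periodic y (2 * Real.pi))
    (hyD : ∀ s, (y s, s) ∈ D)
    (hyd : ∀ s, HasDerivAt y (((X (y s, s)).2)⁻¹ • (X (y s, s)).1) s)
    (hXc : Continuous fun s => X (y s, s)) (hXper : ∀ s, X (y s, s + 2 * Real.pi) = X (y s, s))
    (hη : η ≤ 1 / 2) (hX : ∀ s, |(X (y s, s)).2 - 1| ≤ η) :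
    ∃ (γ : ℝ → Lifted n) (T : ℝ), |T - 2 * Real.pi| ≤ 4 * Real.pi * η ∧
      (∀ t, (γ t).1 = y (γ t).2) ∧ (∀ t, γ (t + T) = γ t + (0, 2 * Real.pi)) ∧
      IsClosedOrbit X D γ T := by
  obtain ⟨x, T, hx0, hT, hT', hx, hxT⟩ := exists_phase (g := fun s => (X (y s, s)).2)
    hXc.snd (fun s => by simp only [hyper s, hXper s]) hη hX
  have hpos : ∀ s, 0 < (X (y s, s)).2 := fun s => by
    have := abs_le.mp (hX s)
    linarith
  have hmono : StrictMono x := strictMono_of_hasDerivAt_pos hx fun t => hpos _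
  have hγT : ∀ t, (y (x (t + T)), x (t + T)) = (y (x t), x t) + (0, 2 * Real.pi) := fun t => by
    rw [hxT, hyper]
    simp
  refine ⟨fun t => (y (x t), x t), T, hT', fun t => rfl, hγT, ?_⟩
  refine ⟨fun t => hyD _, fun t => ?_, hT, fun t => ?_, fun s hs0 hsT => ⟨0, fun heq => ?_⟩⟩
  · have h1 := (hyd (x t)).scomp t (hx t)
    rw [smul_smul, mul_inv_cancel₀ (hpos _).ne', one_smul] at h1
    exact h1.prodMk (hx t)
  · simp only [hγT]
    simp [proj]
  -- The phase starts at 0 and increases strictly to 2π at time T, so at an intermediate time it is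
  -- not a multiple of 2π.
  · have h1 : ((x s : ℝ) : AddCircle (2 * Real.pi)) = 0 := by
      have := congrArg Prod.snd heq
      simpa [proj, hx0] using this
    obtain ⟨k, hk⟩ := (AddCircle.coe_eq_zero_iff _).mp h1
    have h2 : 0 < x s := by rw [← hx0]; exact hmono hs0
    have h3 : x s < 2 * Real.pi := by
      have := hmono hsT
      have h4 := hxT 0
      rw [zero_add, hx0, zero_add] at h4
      rwa [h4] at this
    rw [← hk, zsmul_eq_mul] at h2 h3
    have h4 : (0 : ℝ) < k := by
      by_contra! h
      nlinarith [Real.two_pi_pos]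
    have h5 : (k : ℝ) < 1 := by
      by_contra! h
      nlinarith [Real.two_pi_pos]
    have h6 : (0 : ℤ) < k := by exact_mod_cast h4
    have h7 : k < (1 : ℤ) := by exact_mod_cast h5
    omega

/-- Near a hyperbolic equilibrium of the slow equation, a periodic solution of the reduced equation
gives a limit cycle. -/
theorem IsControlled.exists_isLimitCycle {F : Slow n → Lifted n} {W : Lifted n → Lifted n}
    {χ₀ : Slow n} {r K : ℝ} (h : IsControlled F W χ₀ r K) {U : Set (Slow n)}
    (hU : Metric.closedBall χ₀ r ⊆ U) {A : Slow n →L[ℝ] Slow n}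
    (hAF : ∀ x, A x = (fderiv ℝ F χ₀ x).1)
    (hA : ∀ z ∈ complexEigenvalues (A : Slow n →ₗ[ℝ] Slow n), z.re ≠ 0) :
    ∃ ρ > 0, ρ ≤ r ∧ ∀ᶠ ε in 𝓝[>] (0 : ℝ), ∀ y : ℝ → Slow n, Function.Periodic y (2 * Real.pi) →
      (∀ s, y s ∈ Metric.ball χ₀ ρ) →
      (∀ s, HasDerivAt y
        (((bundledField F W ε (y s, s)).2)⁻¹ • (bundledField F W ε (y s, s)).1) s) →
      ∃ (γ : ℝ → Lifted n) (T : ℝ), |T - 2 * Real.pi| ≤ 8 * Real.pi * K * ε ∧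
        (∀ t, (γ t).1 = y (γ t).2) ∧ (∀ t, γ (t + T) = γ t + (0, 2 * Real.pi)) ∧
        (orbit γ = Set.range fun s => proj (y s, s)) ∧
        IsLimitCycle (bundledField F W ε) (U ×ˢ Set.univ) γ T := by
  have hK := h.K_nonneg
  obtain ⟨δ, hδ, hzero⟩ := exists_pos_eq_zero_of_periodic hA
  -- Kρ takes half of the admissible relative error δ; the terms of order ε take the other half.
  set ρ := min r (min 1 (δ / (2 * (K + 1)))) with hρ
  have hρ0 : 0 < ρ := lt_min h.r_pos (lt_min one_pos (by positivity))
  have hρr : ρ ≤ r := min_le_left _ _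
  have hρ1 : ρ ≤ 1 := (min_le_right _ _).trans (min_le_left _ _)
  have hρδ : K * ρ ≤ δ / 2 := by
    have h1 : ρ ≤ δ / (2 * (K + 1)) := (min_le_right _ _).trans (min_le_right _ _)
    rw [le_div_iff₀ (by positivity)] at h1
    nlinarith
  refine ⟨ρ, hρ0, hρr, ?_⟩
  have hev : ∀ {f : ℝ → ℝ} {c : ℝ}, Continuous f → f 0 < c → ∀ᶠ ε in 𝓝[>] (0 : ℝ), f ε ≤ c :=
    fun hf hc => ((hf.tendsto 0).eventually_le_const hc).filter_mono nhdsWithin_le_nhds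
  have e1 : ∀ᶠ ε : ℝ in 𝓝[>] 0, ε ≤ 1 := hev continuous_id one_pos
  have e2 : ∀ᶠ ε : ℝ in 𝓝[>] 0, 2 * K * ε ≤ 1 / 2 := hev (by fun_prop) (by norm_num)
  have e3 : ∀ᶠ ε : ℝ in 𝓝[>] 0, ε * (K + 12 * K ^ 2) ≤ δ / 2 := hev (by fun_prop) (by simpa)
  filter_upwards [e1, e2, e3, self_mem_nhdsWithin] with ε hε1 hKε hεδ hε
  have hε : 0 < ε := hε
  intro y hyper hyρ hyd
  have hsubρ := Metric.closedBall_subset_closedBall (x := χ₀) hρr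
  have hyρ' : ∀ s, y s ∈ Metric.closedBall χ₀ ρ := fun s => Metric.ball_subset_closedBall (hyρ s)
  have hyr : ∀ s, y s ∈ Metric.closedBall χ₀ r := fun s => hsubρ (hyρ' s)
  have hyc : Continuous y := continuous_iff_continuousAt.mpr fun s => (hyd s).continuousAt
  obtain ⟨γ, T, hT, hγy, hγT, hγ⟩ := exists_isClosedOrbit_of_graph (X := bundledField F W ε)
    (D := U ×ˢ Set.univ) hyper (fun s => ⟨hU (hyr s), Set.mem_univ _⟩) hyd
    ((h.continuousOn_bundledField ε).comp_continuous (hyc.prodMk continuous_id)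
      fun s => ⟨hyr s, Set.mem_univ _⟩)
    (fun s => h.bundledField_periodic ε (hyr s) s) hKε
    (fun s => h.abs_bundledField_snd_sub_le hε.le hε1 (hyr s))
  have hgraph : ∀ (γ' : ℝ → Lifted n) (T' : ℝ),
      IsClosedOrbit (bundledField F W ε) (U ×ˢ Set.univ) γ' T' →
      (∀ t, (γ' t).1 ∈ Metric.closedBall χ₀ ρ) → (∀ t, (γ' t).1 = y (γ' t).2) →
      orbit γ' = Set.range fun s => proj (y s, s) := by
    intro γ' T' hγ' hρ' hy'
    refine orbit_eq_range_graph hy' ?_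
    have hd : ∀ t, HasDerivAt (fun t => (γ' t).2) (bundledField F W ε (γ' t)).2 t :=
      fun t => hasDerivAt_snd (hγ'.hasDerivAt t)
    exact surjective_of_half_le_deriv hd
      fun t => h.half_le_bundledField_snd hε.le hε1 hKε (hsubρ (hρ' t))
  have horb := hgraph γ T hγ (fun t => by rw [hγy]; exact hyρ' _) hγy
  refine ⟨γ, T, hT.trans (le_of_eq (by ring)), hγy, hγT, horb, hγ,
    Prod.fst ⁻¹' Metric.ball χ₀ ρ, Metric.isOpen_ball.preimage continuous_fst, ?_, ?_⟩
  · rw [horb]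
    rintro _ ⟨s, rfl⟩
    exact hyρ s
  · intro γ' T' hγ' hV
    have hρ' : ∀ t, (γ' t).1 ∈ Metric.closedBall χ₀ ρ := fun t => by
      have hb := hV (proj_mem_orbit γ' t)
      rw [Set.mem_preimage] at hb
      exact Metric.ball_subset_closedBall hb
    rw [horb]
    refine hgraph γ' T' hγ' hρ' fun t => ?_
    rw [← sub_eq_zero]
    -- The deviation from the graph at equal phase has the period T' of the other orbit, because y
    -- descends to the circle; the winding number of that orbit plays no role.
    refine hzero (fun t => (γ' t).1 - y (γ' t).2) _ T' ε hγ'.period_pos hε (fun t => ?_)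
      (fun t => (hasDerivAt_fst (hγ'.hasDerivAt t)).sub
        ((hyd (γ' t).2).scomp t (hasDerivAt_snd (hγ'.hasDerivAt t)))) (fun t => ?_) t
    · have h1 := hγ'.periodic t
      rw [proj, proj, Prod.mk.injEq] at h1
      have h2 := h1.1
      have h3 := congrArg hyper.lift h1.2
      rw [hyper.lift_coe, hyper.lift_coe] at h3
      simp only [h2, h3]
    · have h1 := h.norm_slow_velocity_sub_le hε.le hε1 hKε hρr hρ1 (hρ' t) (hyρ' (γ' t).2)
        (γ' t).2
      rw [hAF, smul_smul, ← div_eq_mul_inv]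
      refine h1.trans ?_
      gcongr
      linarith

end SlowFast

/-! ### Linear differential equations and their fundamental solutions -/

section LinearODE

variable {E : Type*} [NormedAddCommGroup E] [NormedSpace ℝ E]

/-- In the norm weighted by exp(-c|t|), integration from 0 has norm at most 1/c, which makes the
Picard map a global contraction for large c. -/
theorem norm_integral_le_of_norm_le_exp {f : ℝ → E} {c M : ℝ} (hc : 0 < c)
    (hf : ∀ s, ‖f s‖ ≤ M * Real.exp (c * |s|)) (t : ℝ) :
    ‖∫ s in (0 : ℝ)..t, f s‖ ≤ M / c * Real.exp (c * |t|) := by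
  have key : ∀ (f : ℝ → E), (∀ s, ‖f s‖ ≤ M * Real.exp (c * |s|)) → ∀ t, 0 ≤ t →
      ‖∫ s in (0 : ℝ)..t, f s‖ ≤ M / c * Real.exp (c * |t|) := by
    intro f hf t ht
    have hM : 0 ≤ M := by
      have := (norm_nonneg _).trans (hf 0)
      simpa using this
    have hd : ∀ s : ℝ, HasDerivAt (fun s => M / c * Real.exp (c * s)) (M * Real.exp (c * s)) s := by
      intro s
      have := (((hasDerivAt_id s).const_mul c).exp).const_mul (M / c)
      refine this.congr_deriv ?_
      simp only [id]
      field_simp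
    have hcont : Continuous fun s : ℝ => M * Real.exp (c * s) := by fun_prop
    have h1 := intervalIntegral.norm_integral_le_of_norm_le (f := f) (μ := MeasureTheory.volume)
      (g := fun s => M * Real.exp (c * s)) ht
      (Eventually.of_forall fun s hs => by
        have := hf s
        rwa [abs_of_pos hs.1] at this) (hcont.intervalIntegrable _ _)
    rw [intervalIntegral.integral_eq_sub_of_hasDerivAt (fun s _ => hd s)
      (hcont.intervalIntegrable _ _)] at h1
    rw [abs_of_nonneg ht]
    have : 0 ≤ M / c * Real.exp (c * 0) := by positivity
    linarith
  rcases le_total 0 t with ht | ht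
  · exact key f hf t ht
  · have h1 := key (fun s => f (-s)) (fun s => by simpa using hf (-s)) (-t) (by linarith)
    rw [intervalIntegral.integral_comp_neg, neg_neg, neg_zero, abs_neg,
      intervalIntegral.integral_symm, norm_neg] at h1
    exact h1

open BoundedContinuousFunction in
/-- Global existence for linear differential equations with bounded continuous coefficients. -/
theorem exists_solution_linear_ode [CompleteSpace E] {B : ℝ → E →L[ℝ] E} (hB : Continuous B)
    {b : ℝ} (hb : ∀ t, ‖B t‖ ≤ b) (x₀ : E) :
    ∃ x : ℝ → E, x 0 = x₀ ∧ ∀ t, HasDerivAt x (B t (x t)) t := by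
  have hb0 : 0 ≤ b := (norm_nonneg _).trans (hb 0)
  -- This weight gives b/c ≤ 1/2. The fixed point u is the solution divided by exp(c|t|), so it can
  -- be sought among bounded functions.
  set c := 2 * b + 1 with hc
  have hc0 : 0 < c := by positivity
  set e : ℝ → ℝ := fun t => Real.exp (c * |t|) with he
  have hec : Continuous e := by fun_prop
  have hepos : ∀ t, 0 < e t := fun t => Real.exp_pos _
  have he1 : ∀ t, 1 ≤ e t := fun t => Real.one_le_exp (by positivity)
  set φ : (ℝ →ᵇ E) → ℝ → E := fun u s => e s • B s (u s) with hφ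
  have hφc : ∀ u, Continuous (φ u) := fun u =>
    hec.smul (hB.clm_apply u.continuous)
  set I : (ℝ →ᵇ E) → ℝ → E := fun u t => x₀ + ∫ s in (0 : ℝ)..t, φ u s with hI
  have hId : ∀ u t, HasDerivAt (I u) (φ u t) t := fun u t =>
    (intervalIntegral.integral_hasDerivAt_right ((hφc u).intervalIntegrable _ _)
      ((hφc u).stronglyMeasurableAtFilter _ _) (hφc u).continuousAt).const_add x₀
  have hIc : ∀ u, Continuous (I u) := fun u =>
    continuous_iff_continuousAt.mpr fun t => (hId u t).continuousAt
  have hint : ∀ (k : ℝ → E) (M : ℝ), 0 ≤ M → (∀ s, ‖k s‖ ≤ M) → ∀ t,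
      ‖∫ s in (0 : ℝ)..t, e s • B s (k s)‖ ≤ 1 / 2 * M * e t := by
    intro k M hM hk t
    have h1 := norm_integral_le_of_norm_le_exp (f := fun s => e s • B s (k s)) (M := b * M) hc0
      (fun s => by
        rw [norm_smul, Real.norm_of_nonneg (hepos s).le, mul_comm]
        exact mul_le_mul_of_nonneg_right ((B s).le_of_opNorm_le_of_le (hb s) (hk s))
          (hepos s).le) t
    refine h1.trans (mul_le_mul_of_nonneg_right ?_ (hepos t).le)
    rw [div_le_iff₀ hc0, hc]
    nlinarith
  have hbound : ∀ u t, ‖(e t)⁻¹ • I u t‖ ≤ ‖x₀‖ + 1 / 2 * ‖u‖ := by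
    intro u t
    rw [norm_smul, norm_inv, Real.norm_of_nonneg (hepos t).le, inv_mul_le_iff₀ (hepos t)]
    have h1 := hint u ‖u‖ (norm_nonneg _) (fun s => norm_coe_le_norm u s) t
    have h2 := norm_add_le x₀ (∫ s in (0 : ℝ)..t, φ u s)
    have h3 : ‖x₀‖ ≤ e t * ‖x₀‖ := by nlinarith [he1 t, norm_nonneg x₀]
    have h4 : ‖∫ s in (0 : ℝ)..t, φ u s‖ ≤ 1 / 2 * ‖u‖ * e t := h1
    calc ‖I u t‖ ≤ ‖x₀‖ + ‖∫ s in (0 : ℝ)..t, φ u s‖ := h2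
      _ ≤ e t * (‖x₀‖ + 1 / 2 * ‖u‖) := by linarith
  set f : (ℝ →ᵇ E) → (ℝ →ᵇ E) := fun u => ofNormedAddCommGroup (fun t => (e t)⁻¹ • I u t)
    ((hec.inv₀ fun t => (hepos t).ne').smul (hIc u)) _ (hbound u)
  have hf : ContractingWith (1 / 2) f := by
    refine ⟨by norm_num, LipschitzWith.of_dist_le_mul fun u v => ?_⟩
    rw [dist_le (by positivity)]
    intro t
    have h1 : f u t - f v t = (e t)⁻¹ • ∫ s in (0 : ℝ)..t, e s • B s (u s - v s) := by
      change (e t)⁻¹ • I u t - (e t)⁻¹ • I v t = _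
      rw [← smul_sub]
      congr 1
      simp only [hI, add_sub_add_left_eq_sub]
      rw [← intervalIntegral.integral_sub ((hφc u).intervalIntegrable _ _)
        ((hφc v).intervalIntegrable _ _)]
      simp only [hφ, map_sub, smul_sub]
    have h2 := hint (fun s => u s - v s) (dist u v) dist_nonneg
      (fun s => by rw [← dist_eq_norm]; exact dist_coe_le_dist s) t
    rw [dist_eq_norm, h1, norm_smul, norm_inv, Real.norm_of_nonneg (hepos t).le,
      inv_mul_le_iff₀ (hepos t)]
    refine h2.trans (le_of_eq ?_)
    push_cast
    ring
  set u := ContractingWith.fixedPoint f hf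
  have hu : ∀ t, I u t = e t • u t := fun t => by
    have h1 : f u = u := hf.fixedPoint_isFixedPt
    have h2 : (e t)⁻¹ • I u t = u t := congrArg (fun v : ℝ →ᵇ E => v t) h1
    rw [← h2, smul_smul, mul_inv_cancel₀ (hepos t).ne', one_smul]
  refine ⟨I u, by simp [hI], fun t => ?_⟩
  refine (hId u t).congr_deriv ?_
  rw [hu, map_smul]

theorem eq_of_linear_ode {B : ℝ → E →L[ℝ] E} {b : ℝ} (hb : ∀ t, ‖B t‖ ≤ b) {x y : ℝ → E}
    (hx : ∀ t, HasDerivAt x (B t (x t)) t) (hy : ∀ t, HasDerivAt y (B t (y t)) t)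
    (h0 : x 0 = y 0) : x = y := by
  refine ODE_solution_unique_univ (v := fun t => B t) (s := fun _ => Set.univ) (K := b.toNNReal)
    (t₀ := 0) (fun t => ?_) (fun t => ⟨hx t, Set.mem_univ _⟩) (fun t => ⟨hy t, Set.mem_univ _⟩) h0
  refine LipschitzWith.lipschitzOnWith ((B t).lipschitz.weaken ?_)
  rw [← NNReal.coe_le_coe, coe_nnnorm]
  exact (hb t).trans (Real.le_coe_toNNReal b)

/-- The matrix equation is itself a linear equation in the space of operators, with left composition
by `B t` as coefficient, of norm at most b. -/
theorem exists_fundamental_solution [CompleteSpace E] {B : ℝ → E →L[ℝ] E} (hB : Continuous B)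
    {b : ℝ} (hb : ∀ t, ‖B t‖ ≤ b) :
    ∃ Φ : ℝ → E →L[ℝ] E, Φ 0 = ContinuousLinearMap.id ℝ E ∧
      ∀ t, HasDerivAt Φ ((B t).comp (Φ t)) t := by
  have hb0 : 0 ≤ b := (norm_nonneg _).trans (hb 0)
  obtain ⟨Φ, h0, hΦ⟩ := exists_solution_linear_ode
    (B := fun t => ContinuousLinearMap.compL ℝ E E E (B t))
    ((ContinuousLinearMap.compL ℝ E E E).continuous.comp hB) (b := b) (fun t => by
      refine ContinuousLinearMap.opNorm_le_bound _ hb0 fun Ψ => ?_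
      refine ((B t).opNorm_comp_le Ψ).trans ?_
      exact mul_le_mul_of_nonneg_right (hb t) (norm_nonneg _)) (ContinuousLinearMap.id ℝ E)
  exact ⟨Φ, h0, hΦ⟩

/-- First order expansion of the monodromy of a linear system with small coefficients. -/
theorem norm_fundamental_solution_sub_le {B Φ : ℝ → E →L[ℝ] E} {B₀ : E →L[ℝ] E} {b β T : ℝ}
    (hb : ∀ t, ‖B t‖ ≤ b) (hβ : ∀ t, ‖B t - B₀‖ ≤ β) (hT : 0 ≤ T) (hbT : b * T ≤ 1 / 2)
    (h0 : Φ 0 = ContinuousLinearMap.id ℝ E) (hΦ : ∀ t, HasDerivAt Φ ((B t).comp (Φ t)) t) :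
    ‖Φ T - ContinuousLinearMap.id ℝ E - T • B₀‖ ≤ T * (β + 2 * b ^ 2 * T) := by
  have hb0 : 0 ≤ b := (norm_nonneg _).trans (hb 0)
  have hc : Continuous Φ := continuous_iff_continuousAt.mpr fun t => (hΦ t).continuousAt
  obtain ⟨t₁, ht₁, hmax⟩ := isCompact_Icc.exists_isMaxOn (s := Set.Icc 0 T)
    ⟨0, Set.left_mem_Icc.mpr hT⟩ hc.norm.continuousOn
  have hM : ∀ t ∈ Set.Icc 0 T, ‖Φ t‖ ≤ ‖Φ t₁‖ := fun t ht => hmax ht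
  have h1 : ∀ t ∈ Set.Icc 0 T, ‖Φ t - ContinuousLinearMap.id ℝ E‖ ≤ b * ‖Φ t₁‖ * t := by
    intro t ht
    have := norm_image_sub_le_of_norm_deriv_le_segment' (f := Φ) (a := 0) (b := T)
      (C := b * ‖Φ t₁‖) (fun x _ => (hΦ x).hasDerivWithinAt) (fun x hx => by
        refine ((B x).opNorm_comp_le _).trans ?_
        exact mul_le_mul (hb x) (hM x (Set.Ico_subset_Icc_self hx)) (norm_nonneg _) hb0) t ht
    rwa [h0, sub_zero] at this
  -- The maximum m of ‖Φ‖ on [0, T] satisfies m ≤ 1 + bTm ≤ 1 + m/2.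
  have hle2 : ‖Φ t₁‖ ≤ 2 := by
    have h2 := norm_add_le (Φ t₁ - ContinuousLinearMap.id ℝ E) (ContinuousLinearMap.id ℝ E)
    rw [sub_add_cancel] at h2
    have h3 := ContinuousLinearMap.norm_id_le (𝕜 := ℝ) (E := E)
    have h4 := h1 t₁ ht₁
    have h5 : b * ‖Φ t₁‖ * t₁ ≤ b * T * ‖Φ t₁‖ := by
      have := mul_le_mul_of_nonneg_left ht₁.2 (mul_nonneg hb0 (norm_nonneg (Φ t₁)))
      linarith
    have h6 := mul_le_mul_of_nonneg_right hbT (norm_nonneg (Φ t₁))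
    linarith
  have hder : ∀ t, HasDerivAt (fun t => Φ t - t • B₀) ((B t).comp (Φ t) - B₀) t := fun t => by
    have := (hΦ t).sub ((hasDerivAt_id t).smul_const B₀)
    rw [one_smul] at this
    exact this
  have h7 := norm_image_sub_le_of_norm_deriv_le_segment' (f := fun t => Φ t - t • B₀)
    (a := 0) (b := T) (C := β + 2 * b ^ 2 * T) (fun x _ => (hder x).hasDerivWithinAt)
    (fun t ht => by
      have ht' := Set.Ico_subset_Icc_self ht
      have h8 : (B t).comp (Φ t) - B₀ =
          (B t - B₀) + (B t).comp (Φ t - ContinuousLinearMap.id ℝ E) := by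
        rw [ContinuousLinearMap.comp_sub, ContinuousLinearMap.comp_id]
        abel
      rw [h8]
      refine (norm_add_le _ _).trans (add_le_add (hβ t) ?_)
      refine ((B t).opNorm_comp_le _).trans ?_
      have h9 := mul_le_mul (hb t) (h1 t ht') (norm_nonneg _) hb0
      have h10 : b * ‖Φ t₁‖ * t ≤ b * 2 * T := by
        have := ht'.1
        have := ht'.2
        gcongr
      have h11 := mul_le_mul_of_nonneg_left h10 hb0
      linarith) T (Set.right_mem_Icc.mpr hT)
  rw [zero_smul, sub_zero, sub_zero, h0] at h7
  rw [sub_right_comm, mul_comm]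
  exact h7

end LinearODE

/-! ### Splitting off the direction of the flow -/

namespace SlowFast

variable {n : ℕ}

/-- The endomorphism induced by `D` on the quotient by a vector `v` transversal to the slow
space, identified with the slow space. -/
noncomputable def transverseMap (D : Lifted n →L[ℝ] Lifted n) (v : Lifted n) :
    Slow n →L[ℝ] Slow n :=
  (ContinuousLinearMap.fst ℝ (Slow n) ℝ).comp (D.comp (ContinuousLinearMap.inl ℝ (Slow n) ℝ)) -
    ((ContinuousLinearMap.snd ℝ (Slow n) ℝ).comp
      (D.comp (ContinuousLinearMap.inl ℝ (Slow n) ℝ))).smulRight (v.2⁻¹ • v.1)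

theorem transverseMap_apply (D : Lifted n →L[ℝ] Lifted n) (v : Lifted n) (x : Slow n) :
    transverseMap D v x = (D (x, 0)).1 - (D (x, 0)).2 • v.2⁻¹ • v.1 := rfl

/-- In a basis of the slow space completed by v, the matrix of D is block triangular: v spans an
invariant line, and projecting D along v gives the other diagonal block. -/
theorem charpoly_eq_of_eigenvector (D : Lifted n →L[ℝ] Lifted n) {v : Lifted n} (hv : v.2 ≠ 0)
    {c : ℝ} (hD : D v = c • v) :
    (D : Lifted n →ₗ[ℝ] Lifted n).charpoly =
      (transverseMap D v : Slow n →ₗ[ℝ] Slow n).charpoly * (Polynomial.X - Polynomial.C c) := by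
  -- The inverse of S sends (x, a) to (x, 0) + a·v, so conjugation by S moves v to (0, 1).
  let S : Lifted n ≃ₗ[ℝ] Lifted n :=
    { toFun := fun p => (p.1 - (p.2 * v.2⁻¹) • v.1, p.2 * v.2⁻¹)
      map_add' := fun p q => by
        ext1
        · simp only [Prod.fst_add, Prod.snd_add]; module
        · simp only [Prod.snd_add]; ring
      map_smul' := fun a p => by
        ext1
        · simp only [Prod.smul_fst, Prod.smul_snd, smul_eq_mul, RingHom.id_apply]; module
        · simp only [Prod.smul_snd, smul_eq_mul, RingHom.id_apply]; ring
      invFun := fun p => (p.1 + p.2 • v.1, p.2 * v.2)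
      left_inv := fun p => by
        ext1
        · simp
        · simp [hv]
      right_inv := fun p => by
        ext1
        · simp [hv]
        · simp [hv] }
  have hS : ∀ p, S p = (p.1 - (p.2 * v.2⁻¹) • v.1, p.2 * v.2⁻¹) := fun _ => rfl
  have hSs : ∀ p, S.symm p = (p.1 + p.2 • v.1, p.2 * v.2) := fun _ => rfl
  rw [← S.charpoly_conj]
  let b₁ := (EuclideanSpace.basisFun (Fin n) ℝ).toBasis
  let b := b₁.prod (Module.Basis.singleton Unit ℝ)
  rw [← LinearMap.charpoly_toMatrix _ b, ← LinearMap.charpoly_toMatrix _ b₁]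
  have h1 : ∀ x, S.conj (D : Lifted n →ₗ[ℝ] Lifted n) (x, 0) =
      (transverseMap D v x, (D (x, 0)).2 * v.2⁻¹) := fun x => by
    rw [LinearEquiv.conj_apply_apply, hSs, hS, transverseMap_apply]
    simp [smul_smul]
  have h2 : S.conj (D : Lifted n →ₗ[ℝ] Lifted n) (0, 1) = (0, c) := by
    rw [LinearEquiv.conj_apply_apply, hSs, hS]
    have : ((0 : Slow n) + (1 : ℝ) • v.1, 1 * v.2) = v := by simp
    simp only [this, ContinuousLinearMap.coe_coe, hD]
    simp [hv]
  have hmat : LinearMap.toMatrix b b (S.conj (D : Lifted n →ₗ[ℝ] Lifted n)) =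
      Matrix.fromBlocks (LinearMap.toMatrix b₁ b₁ (transverseMap D v : Slow n →ₗ[ℝ] Slow n)) 0
        (Matrix.of fun _ j => (D (b₁ j, 0)).2 * v.2⁻¹) (Matrix.diagonal fun _ => c) := by
    ext i j
    rw [LinearMap.toMatrix_apply]
    rcases j with j | j
    · have hb : b (Sum.inl j) = (b₁ j, 0) := by
        ext1 <;> simp [b]
      rw [hb, h1]
      rcases i with i | i
      · rw [Matrix.fromBlocks_apply₁₁, LinearMap.toMatrix_apply, Module.Basis.prod_repr_inl]
        rfl
      · rw [Matrix.fromBlocks_apply₂₁, Module.Basis.prod_repr_inr]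
        simp
    · have hb : b (Sum.inr j) = (0, 1) := by
        ext1 <;> simp [b]
      rw [hb, h2]
      rcases i with i | i
      · rw [Matrix.fromBlocks_apply₁₂, Module.Basis.prod_repr_inl]
        simp
      · rw [Matrix.fromBlocks_apply₂₂, Module.Basis.prod_repr_inr]
        simp
  rw [hmat, Matrix.charpoly_fromBlocks_zero₁₂, Matrix.charpoly_diagonal]
  simp

end SlowFast

open Polynomial in
/-- The eigenvalues of `1 + κ D`. -/
theorem complexEigenvalues_one_add_smul {V : Type*} [AddCommGroup V] [Module ℝ V]
    [FiniteDimensional ℝ V] (D : Module.End ℝ V) {κ : ℝ} (hκ : κ ≠ 0) :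
    SlowFast.complexEigenvalues (1 + κ • D : Module.End ℝ V) =
      (SlowFast.complexEigenvalues D).map fun z : ℂ => 1 + κ * z := by
  have hκ' : (κ : ℂ) ≠ 0 := by exact_mod_cast hκ
  have hD := (IsAlgClosed.splits (D.charpoly.map (algebraMap ℝ ℂ))).eq_prod_roots_of_monic
    ((LinearMap.charpoly_monic _).map _)
  have hcard : Multiset.card (D.charpoly.map (algebraMap ℝ ℂ)).roots = Module.finrank ℝ V := by
    rw [← (IsAlgClosed.splits (D.charpoly.map (algebraMap ℝ ℂ))).natDegree_eq_card_roots,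
      (LinearMap.charpoly_monic _).natDegree_map, LinearMap.charpoly_natDegree]
  have hpoly : (1 + κ • D : Module.End ℝ V).charpoly.map (algebraMap ℝ ℂ) =
      (((D.charpoly.map (algebraMap ℝ ℂ)).roots.map fun z : ℂ => 1 + κ * z).map
        fun z => X - C z).prod := by
    refine Polynomial.funext fun w => ?_
    rw [← charpoly_complexMatrix, Matrix.eval_charpoly, eval_multiset_prod, Multiset.map_map,
      Multiset.map_map]
    -- Since w - (1 + κD) = κ((w - 1)/κ - D), the determinant acquires one factor κ for each root,
    -- and these are then distributed over the linear factors.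
    have h1 : Matrix.scalar _ w - complexMatrix V (1 + κ • D : Module.End ℝ V) =
        (κ : ℂ) • (Matrix.scalar _ ((w - 1) / κ) - complexMatrix V D) := by
      rw [map_add, map_one, map_smul, smul_sub]
      have h2 : (κ : ℂ) • Matrix.scalar (Fin (Module.finrank ℝ V)) ((w - 1) / κ) =
          Matrix.scalar _ w - 1 := by
        ext i j
        simp only [Matrix.smul_apply, Matrix.scalar_apply, Matrix.sub_apply, Matrix.one_apply,
          Matrix.diagonal_apply, smul_eq_mul]
        split_ifs
        · field_simp
        · simp
      rw [h2, Complex.coe_smul, sub_sub]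
    rw [h1, Matrix.det_smul, ← Matrix.eval_charpoly, charpoly_complexMatrix, hD,
      eval_multiset_prod, Multiset.map_map, Fintype.card_fin, ← hcard]
    rw [← Multiset.prod_replicate, ← Multiset.map_const', ← Multiset.prod_map_mul]
    have hr : (Multiset.map (fun a => X - C a) (D.charpoly.map (algebraMap ℝ ℂ)).roots).prod.roots =
        (D.charpoly.map (algebraMap ℝ ℂ)).roots := by rw [← hD]
    congr 1
    simp only [hr]
    refine Multiset.map_congr rfl fun z _ => ?_
    simp only [Function.comp_apply, eval_sub, eval_X, eval_C]
    field_simp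
    ring
  rw [SlowFast.complexEigenvalues, hpoly, roots_multiset_prod_X_sub_C]
  rfl

/-! ### Uniform bounds and the monodromy -/

namespace SlowFast

variable {n : ℕ}

theorem fderiv_add_period {U : Set (Slow n)} (hU : IsOpen U) {W : Lifted n → Lifted n}
    (hper : ∀ χ ∈ U, Function.Periodic (fun s => W (χ, s)) (2 * Real.pi)) {x : Slow n}
    (hx : x ∈ U) (s : ℝ) : fderiv ℝ W (x, s + 2 * Real.pi) = fderiv ℝ W (x, s) := by
  have h1 : (x, s + 2 * Real.pi) = (x, s) + ((0, 2 * Real.pi) : Lifted n) := by simp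
  rw [h1, ← fderiv_comp_add_right]
  refine Filter.EventuallyEq.fderiv_eq ?_
  have hm : U ×ˢ (Set.univ : Set ℝ) ∈ 𝓝 (x, s) :=
    (hU.prod isOpen_univ).mem_nhds ⟨hx, Set.mem_univ _⟩
  filter_upwards [hm] with p hp
  have h2 : p + (0, 2 * Real.pi) = (p.1, p.2 + 2 * Real.pi) := by ext1 <;> simp
  rw [h2]
  exact hper p.1 hp.1 p.2

theorem exists_bound_of_periodic_of_continuousOn {E : Type*} [NormedAddCommGroup E]
    {S : Set (Slow n)} (hS : IsCompact S) {f : Lifted n → E}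
    (hf : ContinuousOn f (S ×ˢ Set.univ))
    (hper : ∀ χ ∈ S, ∀ s, f (χ, s + 2 * Real.pi) = f (χ, s)) :
    ∃ K, ∀ p : Lifted n, p.1 ∈ S → ‖f p‖ ≤ K := by
  have hc := hS.prod (isCompact_Icc (a := (0 : ℝ)) (b := 2 * Real.pi))
  obtain ⟨K, hK⟩ := hc.exists_bound_of_continuousOn
    (hf.mono (Set.prod_mono_right (Set.subset_univ _)))
  refine ⟨K, fun p hp => ?_⟩
  have hp' : Function.Periodic (fun s => f (p.1, s)) (2 * Real.pi) := fun s => hper p.1 hp s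
  obtain ⟨s, hs, hps⟩ := hp'.exists_mem_Ico₀ Real.two_pi_pos p.2
  have h1 : f p = f (p.1, s) := hps
  rw [h1]
  exact hK _ ⟨hp, Set.Ico_subset_Icc_self hs⟩

/-- C² regularity makes the derivative of F locally Lipschitz. The other bounds come from
compactness of a closed ball, times one period for W. -/
theorem exists_isControlled {U : Set (Slow n)} (hU : IsOpen U) {F : Slow n → Lifted n}
    {W : Lifted n → Lifted n} (hF : ContDiffOn ℝ 2 F U) (hW : ContDiffOn ℝ 2 W (U ×ˢ Set.univ))
    (hper : ∀ χ ∈ U, Function.Periodic (fun s => W (χ, s)) (2 * Real.pi)) {χ₀ : Slow n}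
    (hχ₀ : χ₀ ∈ U) : ∃ r K, Metric.closedBall χ₀ r ⊆ U ∧ IsControlled F W χ₀ r K := by
  have hDF : ContDiffOn ℝ 1 (fderiv ℝ F) U := hF.fderiv_of_isOpen hU (by norm_num)
  have hUo : IsOpen (U ×ˢ (Set.univ : Set ℝ)) := hU.prod isOpen_univ
  have hDW : ContDiffOn ℝ 1 (fderiv ℝ W) (U ×ˢ Set.univ) := hW.fderiv_of_isOpen hUo (by norm_num)
  obtain ⟨L, t, ht, hL⟩ := (hDF.contDiffAt (hU.mem_nhds hχ₀)).exists_lipschitzOnWith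
  obtain ⟨r, hr, hrsub⟩ := Metric.nhds_basis_closedBall.mem_iff.mp
    (Filter.inter_mem (hU.mem_nhds hχ₀) ht)
  have hrU : Metric.closedBall χ₀ r ⊆ U := hrsub.trans Set.inter_subset_left
  have hrt : Metric.closedBall χ₀ r ⊆ t := hrsub.trans Set.inter_subset_right
  have hc : IsCompact (Metric.closedBall χ₀ r) := isCompact_closedBall χ₀ r
  have h0 : χ₀ ∈ Metric.closedBall χ₀ r := Metric.mem_closedBall_self hr.le
  have hprod : Metric.closedBall χ₀ r ×ˢ (Set.univ : Set ℝ) ⊆ U ×ˢ Set.univ :=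
    Set.prod_mono_left hrU
  obtain ⟨K₁, hK₁⟩ := hc.exists_bound_of_continuousOn (hF.continuousOn.mono hrU)
  obtain ⟨K₂, hK₂⟩ := hc.exists_bound_of_continuousOn (hDF.continuousOn.mono hrU)
  obtain ⟨K₃, hK₃⟩ := exists_bound_of_periodic_of_continuousOn hc (hW.continuousOn.mono hprod)
    fun χ hχ s => hper χ (hrU hχ) s
  obtain ⟨K₄, hK₄⟩ := exists_bound_of_periodic_of_continuousOn hc (hDW.continuousOn.mono hprod)
    fun χ hχ s => fderiv_add_period hU hper (hrU hχ) s
  have hK₁0 : 0 ≤ K₁ := (norm_nonneg _).trans (hK₁ _ h0)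
  have hK₂0 : 0 ≤ K₂ := (norm_nonneg _).trans (hK₂ _ h0)
  have hK₃0 : 0 ≤ K₃ := (norm_nonneg _).trans (hK₃ (χ₀, 0) h0)
  have hK₄0 : 0 ≤ K₄ := (norm_nonneg _).trans (hK₄ (χ₀, 0) h0)
  have hL0 : (0 : ℝ) ≤ L := L.2
  refine ⟨r, K₁ + K₂ + K₃ + K₄ + L, hrU, hr, by positivity, fun χ hχ => ?_, fun χ hχ => ?_,
    fun χ hχ => ?_, fun χ hχ => ?_, hDF.continuousOn.mono hrU, fun p hp => ?_, fun p hp => ?_,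
    fun p hp => ?_, hDW.continuousOn.mono hprod, fun χ hχ => hper χ (hrU hχ)⟩
  · exact (hF.contDiffAt (hU.mem_nhds (hrU hχ))).differentiableAt (by norm_num)
  · linarith [hK₁ χ hχ]
  · linarith [hK₂ χ hχ]
  · have h1 := hL.dist_le_mul χ (hrt hχ) χ₀ (hrt h0)
    rw [dist_eq_norm, dist_eq_norm] at h1
    refine h1.trans (mul_le_mul_of_nonneg_right ?_ (norm_nonneg _))
    linarith
  · exact (hW.contDiffAt (hUo.mem_nhds ⟨hrU hp, Set.mem_univ _⟩)).differentiableAt (by norm_num)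
  · linarith [hK₃ p hp]
  · linarith [hK₄ p hp]

theorem complexEigenvalues_eq_zero_cons (D : Lifted n →L[ℝ] Lifted n) {v : Lifted n}
    (hv : v.2 ≠ 0) (hD : D v = 0) :
    complexEigenvalues (D : Lifted n →ₗ[ℝ] Lifted n) =
      0 ::ₘ complexEigenvalues (transverseMap D v : Slow n →ₗ[ℝ] Slow n) := by
  rw [complexEigenvalues, charpoly_eq_of_eigenvector D hv (c := 0) (by rw [hD, zero_smul]),
    Polynomial.map_mul, Polynomial.roots_mul, add_comm]
  · simp [complexEigenvalues]
  · exact mul_ne_zero ((LinearMap.charpoly_monic _).map _).ne_zero (by simp [Polynomial.X_ne_zero])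

/-- A is the slow block of D₀; the correction due to projecting along v instead of the phase axis is
controlled by the slope of v. -/
theorem norm_transverseMap_sub_le {D D₀ : Lifted n →L[ℝ] Lifted n} {v : Lifted n}
    {A : Slow n →L[ℝ] Slow n} {a b d : ℝ} (hA : ∀ x, A x = (D₀ (x, 0)).1) (hDD₀ : ‖D - D₀‖ ≤ a)
    (hD : ‖D‖ ≤ d) (hv : ‖v.2⁻¹ • v.1‖ ≤ b) : ‖transverseMap D v - A‖ ≤ a + d * b := by
  have ha : 0 ≤ a := (norm_nonneg _).trans hDD₀
  have hb : 0 ≤ b := (norm_nonneg _).trans hv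
  have hd : 0 ≤ d := (norm_nonneg _).trans hD
  refine ContinuousLinearMap.opNorm_le_bound _ (by positivity) fun x => ?_
  have hx : ‖((x, 0) : Lifted n)‖ = ‖x‖ := by simp [Prod.norm_def]
  have h1 : (transverseMap D v - A) x = ((D - D₀) (x, 0)).1 - (D (x, 0)).2 • v.2⁻¹ • v.1 := by
    rw [sub_apply, transverseMap_apply, hA, sub_apply, Prod.fst_sub]
    abel
  rw [h1]
  refine (norm_sub_le _ _).trans ?_
  have h2 : ‖((D - D₀) (x, 0)).1‖ ≤ a * ‖x‖ := by
    refine (norm_fst_le _).trans ?_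
    rw [← hx]
    exact (D - D₀).le_of_opNorm_le hDD₀ _
  have h3 : ‖(D (x, 0)).2‖ ≤ d * ‖x‖ := by
    refine (norm_snd_le _).trans ?_
    rw [← hx]
    exact D.le_of_opNorm_le hD _
  rw [norm_smul]
  have h5 := mul_le_mul h3 hv (norm_nonneg _) (mul_nonneg hd (norm_nonneg x))
  linarith

theorem complexEigenvalues_eq_one_cons (M D : Lifted n →L[ℝ] Lifted n) {v : Lifted n}
    (hv : v.2 ≠ 0) (hD : D v = 0) {κ : ℝ} (hκ : κ ≠ 0)
    (hM : M = ContinuousLinearMap.id ℝ (Lifted n) + κ • D) :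
    complexEigenvalues (M : Lifted n →ₗ[ℝ] Lifted n) =
      1 ::ₘ (complexEigenvalues (transverseMap D v : Slow n →ₗ[ℝ] Slow n)).map
        fun z : ℂ => 1 + (κ : ℂ) * z := by
  have h1 : (M : Lifted n →ₗ[ℝ] Lifted n) =
      (1 + κ • (D : Lifted n →ₗ[ℝ] Lifted n) : Module.End ℝ (Lifted n)) := by
    rw [hM]
    rfl
  rw [h1, complexEigenvalues_one_add_smul (D : Lifted n →ₗ[ℝ] Lifted n) hκ,
    complexEigenvalues_eq_zero_cons D hv hD, Multiset.map_cons, mul_zero, add_zero]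

/-- The monodromy of a closed orbit near the equilibrium of the slow equation. -/
theorem IsControlled.exists_monodromy {F : Slow n → Lifted n} {W : Lifted n → Lifted n}
    {χ₀ : Slow n} {r K : ℝ} (h : IsControlled F W χ₀ r K) {A : Slow n →L[ℝ] Slow n}
    (hAF : ∀ x, A x = (fderiv ℝ F χ₀ x).1) {C : ℝ} (hC : 0 ≤ C) :
    ∃ C', ∀ᶠ ε in 𝓝[>] (0 : ℝ), ∀ (γ : ℝ → Lifted n) (T : ℝ),
      (∀ t, HasDerivAt γ (bundledField F W ε (γ t)) t) →
      (∀ t, (γ t).1 ∈ Metric.closedBall χ₀ (C * ε)) → |T - 2 * Real.pi| ≤ 8 * Real.pi * K * ε →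
      (∀ t, γ (t + T) = γ t + (0, 2 * Real.pi)) →
      ∃ (M : Lifted n →L[ℝ] Lifted n) (B : Slow n →L[ℝ] Slow n),
        IsMonodromy (bundledField F W ε) γ T M ∧ ‖B - A‖ ≤ C' * ε ∧ 1 ≤ T ∧ T ≤ 10 ∧
        complexEigenvalues (M : Lifted n →ₗ[ℝ] Lifted n) =
          1 ::ₘ (complexEigenvalues (B : Slow n →ₗ[ℝ] Slow n)).map
            fun z : ℂ => 1 + ((T * ε : ℝ) : ℂ) * z := by
  have hK := h.K_nonneg
  have hχ₀ : χ₀ ∈ Metric.closedBall χ₀ r := Metric.mem_closedBall_self h.r_pos.le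
  set c := K * C + K + 80 * K ^ 2 with hc
  have hc0 : 0 ≤ c := by positivity
  refine ⟨c + (K + c) * (4 * K), ?_⟩
  have hev : ∀ {f : ℝ → ℝ} {c : ℝ}, Continuous f → f 0 < c → ∀ᶠ ε in 𝓝[>] (0 : ℝ), f ε ≤ c :=
    fun hf hc => ((hf.tendsto 0).eventually_le_const hc).filter_mono nhdsWithin_le_nhds
  have e1 : ∀ᶠ ε : ℝ in 𝓝[>] 0, ε ≤ 1 := hev continuous_id one_pos
  -- With T ≤ 10 this gives the condition bT ≤ 1/2 of `norm_fundamental_solution_sub_le` for b =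
  -- 2Kε.
  have e2 : ∀ᶠ ε : ℝ in 𝓝[>] 0, 2 * K * ε ≤ 1 / 20 := hev (by fun_prop) (by norm_num)
  have e3 : ∀ᶠ ε : ℝ in 𝓝[>] 0, C * ε ≤ r := hev (by fun_prop) (by simpa using h.r_pos)
  filter_upwards [e1, e2, e3, self_mem_nhdsWithin] with ε hε1 hKε hCε hε
  have hε : 0 < ε := hε
  intro γ T hγ hγC hT hγT
  have hγr : ∀ t, (γ t).1 ∈ Metric.closedBall χ₀ r := fun t =>
    Metric.closedBall_subset_closedBall hCε (hγC t)
  have hπ := Real.pi_gt_three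
  have hπ' := Real.pi_lt_d2
  have hT1 : 1 ≤ T ∧ T ≤ 10 := by
    have h1 := abs_le.mp hT
    have h2 : 8 * Real.pi * K * ε ≤ 8 * Real.pi * (1 / 40) := by
      have : K * ε ≤ 1 / 40 := by linarith
      nlinarith
    constructor <;> linarith
  have hT0 : 0 < T := by linarith
  set X := bundledField F W ε with hX
  set Bt : ℝ → Lifted n →L[ℝ] Lifted n := fun t => fderiv ℝ X (γ t) with hBt
  set D₀ : Lifted n →L[ℝ] Lifted n :=
    (fderiv ℝ F χ₀).comp (ContinuousLinearMap.fst ℝ (Slow n) ℝ) with hD₀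
  have hBeq : ∀ t, Bt t = ε • (fderiv ℝ F (γ t).1).comp (ContinuousLinearMap.fst ℝ (Slow n) ℝ) +
      ε ^ 2 • fderiv ℝ W (γ t) := by
    intro t
    have h1 : HasFDerivAt (fun p : Lifted n => F p.1)
        ((fderiv ℝ F (γ t).1).comp (ContinuousLinearMap.fst ℝ (Slow n) ℝ)) (γ t) :=
      (h.differentiableAt_slow _ (hγr t)).hasFDerivAt.comp (γ t) hasFDerivAt_fst
    have h2 := (h.differentiableAt _ (hγr t)).hasFDerivAt
    exact (((h1.fun_const_smul ε).const_add _).add (h2.fun_const_smul (ε ^ 2))).fderiv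
  have hγc : Continuous γ := continuous_iff_continuousAt.mpr fun t => (hγ t).continuousAt
  have hBc : Continuous Bt := by
    have h1 : Continuous fun t => fderiv ℝ F (γ t).1 :=
      h.continuousOn_fderiv_slow.comp_continuous hγc.fst hγr
    have h2 : Continuous fun t => fderiv ℝ W (γ t) :=
      h.continuousOn_fderiv.comp_continuous hγc fun t => ⟨hγr t, Set.mem_univ _⟩
    rw [show Bt = _ from funext hBeq]
    exact ((h1.clm_comp continuous_const).const_smul ε).add (h2.const_smul (ε ^ 2))
  have hfst : ∀ L : Slow n →L[ℝ] Lifted n,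
      ‖L.comp (ContinuousLinearMap.fst ℝ (Slow n) ℝ)‖ ≤ ‖L‖ := fun L => by
    have h1 := L.opNorm_comp_le (ContinuousLinearMap.fst ℝ (Slow n) ℝ)
    have h2 := ContinuousLinearMap.norm_fst_le (𝕜 := ℝ) (E := Slow n) (F := ℝ)
    nlinarith [norm_nonneg L]
  have hεK : ε ^ 2 * K ≤ ε * K := mul_le_mul_of_nonneg_right (by nlinarith) hK
  have hBb : ∀ t, ‖Bt t‖ ≤ 2 * K * ε := fun t => by
    rw [hBeq]
    refine (norm_add_le _ _).trans ?_
    rw [norm_smul, norm_smul, norm_pow, Real.norm_of_nonneg hε.le]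
    have h1 := mul_le_mul_of_nonneg_left
      ((hfst _).trans (h.norm_fderiv_slow_le _ (hγr t))) hε.le
    have h2 := mul_le_mul_of_nonneg_left (h.norm_fderiv_le _ (hγr t)) (sq_nonneg ε)
    linarith
  have hBβ : ∀ t, ‖Bt t - ε • D₀‖ ≤ (K * C + K) * ε ^ 2 := fun t => by
    have h0 : Bt t - ε • D₀ = ε • (fderiv ℝ F (γ t).1 - fderiv ℝ F χ₀).comp
        (ContinuousLinearMap.fst ℝ (Slow n) ℝ) + ε ^ 2 • fderiv ℝ W (γ t) := by
      rw [hBeq, ContinuousLinearMap.sub_comp, smul_sub]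
      abel
    rw [h0]
    refine (norm_add_le _ _).trans ?_
    rw [norm_smul, norm_smul, norm_pow, Real.norm_of_nonneg hε.le]
    have h3 := hγC t
    rw [mem_closedBall_iff_norm] at h3
    have h1 := mul_le_mul_of_nonneg_left ((hfst _).trans
      ((h.norm_fderiv_slow_sub_le _ (hγr t)).trans (mul_le_mul_of_nonneg_left h3 hK))) hε.le
    have h2 := mul_le_mul_of_nonneg_left (h.norm_fderiv_le _ (hγr t)) (sq_nonneg ε)
    linarith
  obtain ⟨Φ, hΦ0, hΦ⟩ := exists_fundamental_solution hBc hBb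
  have hMest := norm_fundamental_solution_sub_le hBb hBβ hT0.le (by nlinarith) hΦ0 hΦ
  set v := X (γ 0) with hv
  have hv2 : 1 / 2 ≤ v.2 := h.half_le_bundledField_snd hε.le hε1 (by linarith) (hγr 0)
  have hv2' : v.2 ≠ 0 := by linarith
  have hv1 : ‖v.1‖ ≤ 2 * K * ε := h.norm_bundledField_fst_le hε.le hε1 (hγr 0)
  -- The velocity of the orbit solves the variational equation, and it returns to its initial value
  -- after one period because the field is 2π-periodic in the phase.
  have hMv : Φ T v = v := by
    have h1 : (fun t => Φ t v) = fun t => X (γ t) := by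
      refine eq_of_linear_ode hBb (fun t => ?_) (fun t => ?_) ?_
      · have := (hΦ t).clm_apply (hasDerivAt_const t v)
        simpa using this
      · exact ((h.differentiableAt_bundledField ε (hγr t)).hasFDerivAt).comp_hasDerivAt t (hγ t)
      · simp [hΦ0, hv]
    have h2 : Φ T v = X (γ T) := congrFun h1 T
    have h3 := hγT 0
    rw [zero_add] at h3
    rw [h2, h3, hv]
    have h4 := h.bundledField_periodic ε (hγr 0) (γ 0).2
    have h5 : γ 0 + (0, 2 * Real.pi) = ((γ 0).1, (γ 0).2 + 2 * Real.pi) := by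
      ext1 <;> simp
    rw [h5]
    exact h4
  have hTε : T * ε ≠ 0 := (mul_pos hT0 hε).ne'
  -- D is the monodromy minus the identity, rescaled to have the limit D₀ as ε → 0. The summand 80K²
  -- of c is the second-order term 2(2K)²T with T ≤ 10.
  set D : Lifted n →L[ℝ] Lifted n := (T * ε)⁻¹ • (Φ T - ContinuousLinearMap.id ℝ (Lifted n))
    with hD
  have hDv : D v = 0 := by
    simp [hD, hMv]
  have hDD₀ : ‖D - D₀‖ ≤ c * ε := by
    have h1 : D - D₀ = (T * ε)⁻¹ •
        (Φ T - ContinuousLinearMap.id ℝ (Lifted n) - T • (ε • D₀)) := by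
      rw [smul_sub, smul_smul T ε, smul_smul _ (T * ε) D₀, inv_mul_cancel₀ hTε, one_smul]
    rw [h1, norm_smul, norm_inv, Real.norm_of_nonneg (mul_pos hT0 hε).le,
      inv_mul_le_iff₀ (mul_pos hT0 hε)]
    refine hMest.trans ?_
    have h2 : (K * C + K) * ε ^ 2 + 2 * (2 * K * ε) ^ 2 * T ≤ ε * (c * ε) := by
      have : 2 * (2 * K * ε) ^ 2 * T ≤ 2 * (2 * K * ε) ^ 2 * 10 :=
        mul_le_mul_of_nonneg_left hT1.2 (by positivity)
      rw [hc]
      linarith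
    have h3 := mul_le_mul_of_nonneg_left h2 hT0.le
    linarith
  have hDn : ‖D‖ ≤ K + c := by
    have h1 := norm_add_le (D - D₀) D₀
    rw [sub_add_cancel] at h1
    have h2 : ‖D₀‖ ≤ K := (hfst _).trans (h.norm_fderiv_slow_le _ hχ₀)
    nlinarith
  refine ⟨Φ T, transverseMap D v, ⟨Φ, hΦ0, hΦ, rfl⟩, ?_, hT1.1, hT1.2, ?_⟩
  · have h4 : ‖v.2⁻¹ • v.1‖ ≤ 2 * (2 * K * ε) := by
      rw [norm_smul, norm_inv, Real.norm_of_nonneg (by linarith : 0 ≤ v.2)]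
      refine mul_le_mul ?_ hv1 (norm_nonneg _) (by norm_num)
      have := inv_anti₀ (by norm_num) hv2
      norm_num at this
      exact this
    refine (norm_transverseMap_sub_le (A := A) (fun x => hAF x) hDD₀ hDn h4).trans (le_of_eq ?_)
    ring
  · exact complexEigenvalues_eq_one_cons (Φ T) D (v := v) hv2' hDv hTε (by
      rw [hD, smul_smul, mul_inv_cancel₀ hTε, one_smul, add_sub_cancel])

/-- A kernel vector would make 0 an eigenvalue, with real part 0. -/
theorem exists_continuousLinearEquiv_of_hyperbolic {A : Slow n →L[ℝ] Slow n}
    (hA : ∀ z ∈ complexEigenvalues (A : Slow n →ₗ[ℝ] Slow n), z.re ≠ 0) :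
    ∃ e : Slow n ≃L[ℝ] Slow n, ∀ x, e x = A x := by
  have hinj : Function.Injective (A : Slow n →ₗ[ℝ] Slow n) := by
    rw [← LinearMap.ker_eq_bot, LinearMap.ker_eq_bot']
    intro x hx
    by_contra hx0
    have h1 : Module.End.HasEigenvalue (A : Slow n →ₗ[ℝ] Slow n) 0 := by
      refine Module.End.hasEigenvalue_of_hasEigenvector (x := x) ⟨?_, hx0⟩
      rw [Module.End.mem_eigenspace_iff, hx, zero_smul]
    rw [Module.End.hasEigenvalue_iff_isRoot_charpoly] at h1
    refine hA 0 ?_ Complex.zero_re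
    rw [complexEigenvalues, Polynomial.mem_roots ((LinearMap.charpoly_monic _).map _).ne_zero]
    simpa using h1.map (f := algebraMap ℝ ℂ)
  exact ⟨(LinearEquiv.ofInjectiveEndo _ hinj).toContinuousLinearEquiv, fun x => rfl⟩

theorem exists_fin_labelling {α : Type*} (s : Multiset α) {n : ℕ} (hs : Multiset.card s = n) :
    ∃ f : Fin n → α, Finset.univ.val.map f = s := by
  obtain ⟨l, rfl⟩ : ∃ l : List α, (l : Multiset α) = s := ⟨s.toList, s.coe_toList⟩
  rw [Multiset.coe_card] at hs
  subst hs
  exact ⟨l.get, by rw [Fin.univ_val_map, List.ofFn_get]⟩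

theorem card_complexEigenvalues (A : Slow n →ₗ[ℝ] Slow n) :
    Multiset.card (complexEigenvalues A) = n := by
  rw [complexEigenvalues, ← (IsAlgClosed.splits _).natDegree_eq_card_roots,
    (LinearMap.charpoly_monic _).natDegree_map, LinearMap.charpoly_natDegree,
    finrank_euclideanSpace_fin]

theorem hausdorffEDist_graph_le {y z : ℝ → Slow n} {C : ℝ} (h : ∀ s, dist (y s) (z s) ≤ C) :
    Metric.hausdorffEDist (Set.range fun s => proj (y s, s)) (Set.range fun s => proj (z s, s)) ≤
      ENNReal.ofReal C := by
  have key : ∀ s, edist (proj (y s, s)) (proj (z s, s)) ≤ ENNReal.ofReal C := fun s => by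
    rw [proj, proj, Prod.edist_eq]
    simp only [edist_self, max_le_iff, zero_le, and_true]
    rw [edist_dist]
    exact ENNReal.ofReal_le_ofReal (h s)
  refine Metric.hausdorffEDist_le_of_mem_edist ?_ ?_
  · rintro _ ⟨s, rfl⟩
    exact ⟨_, ⟨s, rfl⟩, key s⟩
  · rintro _ ⟨s, rfl⟩
    exact ⟨_, ⟨s, rfl⟩, by rw [edist_comm]; exact key s⟩

theorem range_proj_const (χ₀ : Slow n) :
    (Set.range fun s : ℝ => proj (χ₀, s)) = {χ₀} ×ˢ Set.univ := by
  ext c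
  constructor
  · rintro ⟨s, rfl⟩
    exact ⟨rfl, Set.mem_univ _⟩
  · rintro ⟨h1, -⟩
    obtain ⟨s, hs⟩ := QuotientAddGroup.mk_surjective c.2
    refine ⟨s, ?_⟩
    ext1
    · exact (Set.mem_singleton_iff.mp h1).symm
    · exact hs

/-- Logarithms of `1 + T ε b`, compared with `T ε b`. -/
theorem isBigO_log_div_sub {T : ℝ → ℝ} {b : ℝ → ℂ} {z : ℂ}
    (hT : ∀ᶠ ε in 𝓝[>] (0 : ℝ), 1 ≤ T ε ∧ T ε ≤ 10) (hb : Tendsto b (𝓝[>] 0) (𝓝 z)) :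
    (∀ᶠ ε in 𝓝[>] (0 : ℝ), Complex.exp (T ε * (Complex.log (1 + ((T ε * ε : ℝ) : ℂ) * b ε) / T ε)) =
      1 + ((T ε * ε : ℝ) : ℂ) * b ε) ∧
    (fun ε : ℝ => Complex.log (1 + ((T ε * ε : ℝ) : ℂ) * b ε) / T ε - ε * b ε) =O[𝓝[>] 0]
      fun ε : ℝ => ε ^ 2 := by
  set m := ‖z‖ + 1
  have hm : 0 < m := by positivity
  have hbm : ∀ᶠ ε in 𝓝[>] (0 : ℝ), ‖b ε‖ ≤ m :=
    hb.norm.eventually_le_const (lt_add_one _)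
  have hε : ∀ᶠ ε : ℝ in 𝓝[>] 0, 10 * ε * m ≤ 1 / 2 := by
    have : Continuous fun ε : ℝ => 10 * ε * m := by fun_prop
    exact ((this.tendsto 0).eventually_le_const (by norm_num)).filter_mono nhdsWithin_le_nhds
  have hsmall : ∀ᶠ ε in 𝓝[>] (0 : ℝ), 0 < ε ∧ 1 ≤ T ε ∧ ‖((T ε * ε : ℝ) : ℂ) * b ε‖ ≤ 10 * ε * m ∧
      10 * ε * m ≤ 1 / 2 := by
    filter_upwards [hT, hbm, hε, self_mem_nhdsWithin] with ε hTε hbε hε hpos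
    have hpos : 0 < ε := hpos
    refine ⟨hpos, hTε.1, ?_, hε⟩
    have h1 : 0 ≤ T ε := by linarith
    rw [norm_mul, Complex.norm_of_nonneg (by positivity)]
    exact mul_le_mul (mul_le_mul_of_nonneg_right hTε.2 hpos.le) hbε (norm_nonneg _)
      (by positivity)
  constructor
  · filter_upwards [hsmall] with ε ⟨hpos, hT1, hle, hhalf⟩
    have hT0 : (T ε : ℂ) ≠ 0 := by
      have : T ε ≠ 0 := by linarith
      exact_mod_cast this
    rw [mul_div_cancel₀ _ hT0, Complex.exp_log]
    intro h0
    have h1 : ((T ε * ε : ℝ) : ℂ) * b ε = -1 := by linear_combination h0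
    rw [h1, norm_neg, norm_one] at hle
    linarith
  -- For |w| ≤ 1/2 one has |log(1 + w) - w| ≤ |w|², and here |w| ≤ 10εm; dividing by T ≥ 1 does no
  -- harm.
  · refine IsBigO.of_bound (100 * m ^ 2) ?_
    filter_upwards [hsmall] with ε ⟨hpos, hT1, hle, hhalf⟩
    have hT0 : (T ε : ℂ) ≠ 0 := by
      have : T ε ≠ 0 := by linarith
      exact_mod_cast this
    set w := ((T ε * ε : ℝ) : ℂ) * b ε with hw
    have h1 : Complex.log (1 + w) / T ε - ε * b ε = (Complex.log (1 + w) - w) / T ε := by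
      rw [sub_div, hw]
      congr 1
      push_cast
      field_simp
    have hw1 : ‖w‖ < 1 := by linarith
    have h2 := Complex.norm_log_one_add_sub_self_le hw1
    have h3 : (1 - ‖w‖)⁻¹ ≤ 2 := by
      have := inv_anti₀ (by norm_num) (show (1 / 2 : ℝ) ≤ 1 - ‖w‖ by linarith)
      norm_num at this
      exact this
    have h4 : ‖Complex.log (1 + w) - w‖ ≤ ‖w‖ ^ 2 := by
      have := mul_le_mul_of_nonneg_left h3 (sq_nonneg ‖w‖)
      linarith
    have h5 : ‖w‖ ^ 2 ≤ (10 * ε * m) ^ 2 := pow_le_pow_left₀ (norm_nonneg _) hle 2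
    rw [h1, norm_div, Complex.norm_of_nonneg (by linarith : 0 ≤ T ε), norm_pow,
      Real.norm_of_nonneg hpos.le, div_le_iff₀ (by linarith)]
    have h6 : 0 ≤ 100 * m ^ 2 * ε ^ 2 := by positivity
    nlinarith

end SlowFast

/-! ### Assembly of the main theorem -/

open SlowFast in
-- Diagonalizability over ℂ is expressed by semisimplicity over ℝ: as ℝ is perfect, both mean that
-- the minimal polynomial is squarefree.
theorem mainTheorem2 (n : ℕ) (U : Set (SlowFast.Slow n)) (hU : IsOpen U)
    (F₁ : SlowFast.Slow n → SlowFast.Slow n) (G₁ : SlowFast.Slow n → ℝ)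
    (F₂ : SlowFast.Slow n → ℝ → SlowFast.Slow n) (G₂ : SlowFast.Slow n → ℝ → ℝ)
    (hF₁ : ContDiffOn ℝ 2 F₁ U) (hG₁ : ContDiffOn ℝ 2 G₁ U)
    (hF₂ : ContDiffOn ℝ 2 (fun p : SlowFast.Lifted n => F₂ p.1 p.2) (U ×ˢ Set.univ))
    (hG₂ : ContDiffOn ℝ 2 (fun p : SlowFast.Lifted n => G₂ p.1 p.2) (U ×ˢ Set.univ))
    (hF₂per : ∀ χ ∈ U, Function.Periodic (F₂ χ) (2 * Real.pi))
    (hG₂per : ∀ χ ∈ U, Function.Periodic (G₂ χ) (2 * Real.pi))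
    (χ₀ : SlowFast.Slow n) (hχ₀ : χ₀ ∈ U) (hzero : F₁ χ₀ = 0)
    (hhyp : ∀ z ∈ SlowFast.complexEigenvalues
      (fderiv ℝ F₁ χ₀ : SlowFast.Slow n →ₗ[ℝ] SlowFast.Slow n), z.re ≠ 0) :
    ∃ (ε₀ C : ℝ) (γ₀ γ : ℝ → ℝ → SlowFast.Lifted n) (T₀ T : ℝ → ℝ)
      (lam : Fin n → ℂ) (μ : ℝ → Fin n → ℂ),
      0 < ε₀ ∧
      Finset.univ.val.map lam = SlowFast.complexEigenvalues
        (fderiv ℝ F₁ χ₀ : SlowFast.Slow n →ₗ[ℝ] SlowFast.Slow n) ∧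
      (∀ ε : ℝ, 0 < ε → ε < ε₀ →
        -- the limit cycle of the truncated system
        SlowFast.orbit (γ₀ ε) = {χ₀} ×ˢ Set.univ ∧
        SlowFast.IsLimitCycle (SlowFast.truncatedField F₁ G₁ ε) (U ×ˢ Set.univ) (γ₀ ε) (T₀ ε) ∧
        -- the limit cycle of the full system
        SlowFast.IsLimitCycle (SlowFast.fullField F₁ G₁ F₂ G₂ ε) (U ×ˢ Set.univ) (γ ε) (T ε) ∧
        Metric.hausdorffEDist (SlowFast.orbit (γ ε)) (SlowFast.orbit (γ₀ ε)) ≤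
          ENNReal.ofReal (C * ε) ∧
        -- its Floquet exponents are 0 and `μ ε i`
        SlowFast.IsFloquetExponents (SlowFast.fullField F₁ G₁ F₂ G₂ ε) (γ ε) (T ε)
          (0 ::ₘ Finset.univ.val.map (μ ε))) ∧
      (∀ i, (fun ε : ℝ => μ ε i - ε * lam i) =o[𝓝[>] 0] fun ε : ℝ => ε) ∧
      (Module.End.IsSemisimple (fderiv ℝ F₁ χ₀ : SlowFast.Slow n →ₗ[ℝ] SlowFast.Slow n) →
        ∀ i, (fun ε : ℝ => μ ε i - ε * lam i) =O[𝓝[>] 0] fun ε : ℝ => ε ^ 2) := by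
  set A := fderiv ℝ F₁ χ₀ with hA
  set F : Slow n → Lifted n := fun χ => (F₁ χ, G₁ χ) with hF
  set W : Lifted n → Lifted n := fun p => (F₂ p.1 p.2, G₂ p.1 p.2) with hW
  obtain ⟨r, K, hrU, h⟩ := exists_isControlled hU (F := F) (W := W) (hF₁.prodMk hG₁)
    (hF₂.prodMk hG₂)
    (fun χ hχ s => by simp only [hW, hF₂per χ hχ s, hG₂per χ hχ s]) hχ₀
  have hAF : ∀ x, A x = (fderiv ℝ F χ₀ x).1 := fun x => by
    have h1 := ((hF₁.contDiffAt (hU.mem_nhds hχ₀)).differentiableAt (by norm_num)).fderiv_prodMk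
      ((hG₁.contDiffAt (hU.mem_nhds hχ₀)).differentiableAt (by norm_num))
    rw [show fderiv ℝ F χ₀ = _ from h1]
    rfl
  have hFχ₀ : (F χ₀).1 = 0 := hzero
  obtain ⟨e, he⟩ := exists_continuousLinearEquiv_of_hyperbolic hhyp
  obtain ⟨lam, hlam⟩ := exists_fin_labelling _ (card_complexEigenvalues (A : Slow n →ₗ[ℝ] Slow n))
  obtain ⟨C, hC, hsol⟩ := h.exists_reduced_periodic_solution hFχ₀ e
    (fun x => (he x).trans (hAF x))
  obtain ⟨ρ, hρ, -, hcyc⟩ := h.exists_isLimitCycle hrU hAF hhyp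
  obtain ⟨ρ', hρ', -, hcyc₀⟩ := h.zero_right.exists_isLimitCycle hrU hAF hhyp
  obtain ⟨C', hmono⟩ := h.exists_monodromy hAF hC
  have hfull : ∀ ε, fullField F₁ G₁ F₂ G₂ ε = bundledField F W ε :=
    fullField_eq_bundledField F₁ G₁ F₂ G₂
  have htrunc : ∀ ε, truncatedField F₁ G₁ ε = bundledField F (fun _ => 0) ε :=
    fullField_eq_bundledField F₁ G₁ (fun _ _ => 0) (fun _ _ => 0)
  have hCρ : ∀ᶠ ε : ℝ in 𝓝[>] 0, C * ε < ρ := by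
    have : Continuous fun ε : ℝ => C * ε := by fun_prop
    exact ((this.tendsto 0).eventually_lt_const (by simpa using hρ)).filter_mono nhdsWithin_le_nhds
  set P : ℝ → (ℝ → Lifted n) → (ℝ → Lifted n) → ℝ → ℝ → (Slow n →L[ℝ] Slow n) → Prop :=
    fun ε γ₀ γ T₀ T B =>
      orbit γ₀ = {χ₀} ×ˢ Set.univ ∧
      IsLimitCycle (truncatedField F₁ G₁ ε) (U ×ˢ Set.univ) γ₀ T₀ ∧
      IsLimitCycle (fullField F₁ G₁ F₂ G₂ ε) (U ×ˢ Set.univ) γ T ∧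
      Metric.hausdorffEDist (orbit γ) (orbit γ₀) ≤ ENNReal.ofReal (C * ε) ∧
      ‖B - A‖ ≤ C' * ε ∧ (1 ≤ T ∧ T ≤ 10) ∧
      ∃ M, IsMonodromy (fullField F₁ G₁ F₂ G₂ ε) γ T M ∧
        complexEigenvalues (M : Lifted n →ₗ[ℝ] Lifted n) =
          1 ::ₘ (complexEigenvalues (B : Slow n →ₗ[ℝ] Slow n)).map
            fun z : ℂ => 1 + ((T * ε : ℝ) : ℂ) * z with hP
  have hex : ∀ᶠ ε in 𝓝[>] (0 : ℝ), ∃ γ₀ γ T₀ T B, P ε γ₀ γ T₀ T B := by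
    filter_upwards [hsol, hcyc, hcyc₀, hmono, hCρ] with ε hsol hcyc hcyc₀ hmono hCρ
    obtain ⟨y, hyper, hyC, hyd⟩ := hsol
    obtain ⟨γ, T, hT, hγy, hγT, horb, hlim⟩ := hcyc y hyper
      (fun s => Metric.closedBall_subset_ball hCρ (hyC s)) hyd
    obtain ⟨γ₀, T₀, -, -, -, horb₀, hlim₀⟩ := hcyc₀ (fun _ => χ₀) (fun _ => rfl)
      (fun _ => Metric.mem_ball_self hρ') (fun s => by
        refine (hasDerivAt_const s χ₀).congr_deriv ?_
        simp [bundledField, hFχ₀])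
    obtain ⟨M, B, hM, hB, hT1, hT10, heig⟩ := hmono γ T hlim.1.hasDerivAt
      (fun t => by rw [hγy]; exact hyC _) hT hγT
    refine ⟨γ₀, γ, T₀, T, B, ?_, ?_, ?_, ?_, hB, ⟨hT1, hT10⟩, M, ?_, heig⟩
    · rw [horb₀, range_proj_const]
    · rw [htrunc]; exact hlim₀
    · rw [hfull]; exact hlim
    · rw [horb, horb₀]
      exact hausdorffEDist_graph_le hyC
    · rw [hfull]; exact hM
  -- The data are needed as functions of every real ε; where no orbit is available they are set to
  -- 0, which the limit ε → 0⁺ does not see.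
  have hex' : ∀ ε, ∃ γ₀ γ T₀ T B, (∃ γ₀ γ T₀ T B, P ε γ₀ γ T₀ T B) → P ε γ₀ γ T₀ T B := fun ε => by
    by_cases hε : ∃ γ₀ γ T₀ T B, P ε γ₀ γ T₀ T B
    · obtain ⟨γ₀, γ, T₀, T, B, hB⟩ := hε
      exact ⟨γ₀, γ, T₀, T, B, fun _ => hB⟩
    · exact ⟨0, 0, 0, 0, 0, fun h' => absurd h' hε⟩
  choose γ₀ γ T₀ T B hPB using hex'
  have hev : ∀ᶠ ε in 𝓝[>] (0 : ℝ), P ε (γ₀ ε) (γ ε) (T₀ ε) (T ε) (B ε) := by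
    filter_upwards [hex] with ε hε using hPB ε hε
  have hBO : (fun ε => B ε - A) =O[𝓝[>] 0] fun ε : ℝ => ε := by
    refine IsBigO.of_bound C' ?_
    filter_upwards [hev, self_mem_nhdsWithin] with ε hε hpos
    rw [Real.norm_of_nonneg (le_of_lt hpos)]
    exact hε.2.2.2.2.1
  have hid : Tendsto (fun ε : ℝ => ε) (𝓝[>] 0) (𝓝 0) := nhdsWithin_le_nhds
  have hBlim : Tendsto B (𝓝[>] 0) (𝓝 A) :=
    tendsto_sub_nhds_zero_iff.mp (hBO.trans_tendsto hid)
  obtain ⟨b, hbchar, hblim⟩ := exists_tendsto_eigenvalues finrank_euclideanSpace_fin hBlim hlam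
  have hbroots : ∀ ε, complexEigenvalues (B ε : Slow n →ₗ[ℝ] Slow n) =
      Finset.univ.val.map (b ε) := fun ε => by
    rw [complexEigenvalues, hbchar]
    have := Polynomial.roots_multiset_prod_X_sub_C (Finset.univ.val.map (b ε))
    rw [Multiset.map_map] at this
    exact this
  have hTev : ∀ᶠ ε in 𝓝[>] (0 : ℝ), 1 ≤ T ε ∧ T ε ≤ 10 := hev.mono fun ε hε => hε.2.2.2.2.2.1
  have hlog := fun i => isBigO_log_div_sub hTev (hblim i)
  set μ : ℝ → Fin n → ℂ := fun ε i =>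
    Complex.log (1 + ((T ε * ε : ℝ) : ℂ) * b ε i) / T ε with hμ
  -- The first summand is the error of the logarithm, always O(ε²); the second is ε times the
  -- displacement of the eigenvalue, which decides between o(ε) and O(ε²).
  have hdec : ∀ i, (fun ε : ℝ => μ ε i - ε * lam i) = fun ε : ℝ =>
      (μ ε i - ε * b ε i) + (ε : ℂ) * (b ε i - lam i) := fun i => by
    funext ε
    ring
  have hidC : (fun ε : ℝ => (ε : ℂ)) =O[𝓝[>] 0] fun ε : ℝ => ε :=
    IsBigO.of_bound 1 (Eventually.of_forall fun ε => by simp)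
  have hexp : ∀ᶠ ε in 𝓝[>] (0 : ℝ), ∀ i, Complex.exp (T ε * μ ε i) =
      1 + ((T ε * ε : ℝ) : ℂ) * b ε i := eventually_all.mpr fun i => (hlog i).1
  obtain ⟨ε₀, hε₀, hgood⟩ := mem_nhdsGT_iff_exists_Ioo_subset.mp (hev.and hexp)
  refine ⟨ε₀, C, γ₀, γ, T₀, T, lam, μ, hε₀, hlam, fun ε hpos hlt => ?_, fun i => ?_,
    fun hss i => ?_⟩
  · obtain ⟨⟨h1, h2, h3, h4, -, -, M, hM, heig⟩, hexpε⟩ := hgood ⟨hpos, hlt⟩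
    refine ⟨h1, h2, h3, h4, M, hM, ?_⟩
    rw [heig, hbroots, Multiset.map_cons, mul_zero, Complex.exp_zero, Multiset.map_map,
      Multiset.map_map]
    congr 1
    exact Multiset.map_congr rfl fun i _ => (hexpε i).symm
  · rw [hdec]
    have hsq : (fun ε : ℝ => ε ^ 2) =o[𝓝[>] 0] fun ε : ℝ => ε := by
      have h1 := (isLittleO_pow_id (𝕜 := ℝ) one_lt_two).mono
        (nhdsWithin_le_nhds (a := (0 : ℝ)) (s := Set.Ioi 0))
      exact h1
    refine ((hlog i).2.trans_isLittleO hsq).add ?_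
    have h1 : (fun ε => b ε i - lam i) =o[𝓝[>] 0] fun _ => (1 : ℝ) := by
      rw [isLittleO_one_iff]
      exact tendsto_sub_nhds_zero_iff.mpr (hblim i)
    simpa using hidC.mul_isLittleO h1
  · rw [hdec]
    have h1 : (fun ε => b ε i - lam i) =O[𝓝[>] 0] fun ε : ℝ => ε := by
      refine eigenvalue_isBigO_of_isSemisimple hss hBlim hBO ?_ (fun ε => ?_) (hblim i)
      · rw [← hlam]
        exact Multiset.mem_map_of_mem _ (Finset.mem_univ i)
      · rw [hbchar]
        rw [Polynomial.IsRoot, Polynomial.eval_prod]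
        exact Finset.prod_eq_zero (Finset.mem_univ i) (by simp)
    refine (hlog i).2.add ?_
    simpa [sq] using hidC.mul h1
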